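/- **Lemma.** Let $M, D_1, D_2 \ge 1$ be integers. Let $\|\cdot\|_p$ be any norm on $\mathbb{R}^{D_1\times D_1}$ and let $\|\cdot\|_b$ be any norm on $\mathbb{R}^{D_2\times D_2}$. Write $\langle X, Y\rangle = \operatorname{trace}(X^{T}Y)$ and $\|X\|_F = \sqrt{\langle X, X\rangle}$ for matrices of the same size, let $\|X\|_d = \sup_{\|Y\|_p = 1}\langle Y, X\rangle$ be the norm dual to $\|\cdot\|_p$, and put $$\sigma(\|G\|_p) = \sup_{\|Z\|_d = 1}\|Z\|_F .$$ Let $g$ be a standard Gaussian random vector in $\mathbb{R}^M$, let $G_0, G_1, \ldots, G_M$ be random $D_1\times D_1$ matrices and let $G'_1, \ldots, G'_M$ be random $D_2 \times D_2$ matrices, each of these matrices having i.i.d. Gaussian entries of mean zero and variance one, and suppose that $g, G_0, \ldots, G_M, G'_1, \ldots, G'_M$ are mutually independent. Then all of the expectations below are finite (the random variables in them are integrable), and $$ \mathbb{E}\left[\inf_{\|v\|_{\ell_2}=1}\ \inf_{\|Y\|_b=1}\ \sup_{\|Z\|_d=1}\left(\left\langle \sum_{i=1}^M v_i G_i,\,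 Z\right\rangle + \left\langle \sum_{i=1}^M v_i G'_i,\, Y\right\rangle\right)\right] \ \ge\ \mathbb{E}\left[\|G_0\|_p\right] - \mathbb{E}\left[\sup_{\|v\|_{\ell_2}=1}\ \sup_{\|Y\|_b=1}\left(\sigma(\|G\|_p)\,\langle g, v\rangle + \left\langle \sum_{i=1}^M v_i G'_i,\, Y\right\rangle\right)\right], $$ where $v$ ranges over $\mathbb{R}^M$ with the Euclidean norm $\|\cdot\|_{\ell_2}$, $Y$ over $\mathbb{R}^{D_2\times D_2}$ and $Z$ over $\mathbb{R}^{D_1\times D_1}$. -/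

import Mathlib

open MeasureTheory ProbabilityTheory

noncomputable section

/-- Matrices carry the product σ-algebra of their entries. -/
instance matrixMeasurableSpace (m n : ℕ) : MeasurableSpace (Matrix (Fin m) (Fin n) ℝ) :=
  inferInstanceAs (MeasurableSpace (Fin m → Fin n → ℝ))

/-- The Gaussian ensemble: random `m × n` matrices whose entries are i.i.d. centred Gaussians of
variance one. -/
def gaussianEnsemble (m n : ℕ) : Measure (Matrix (Fin m) (Fin n) ℝ) :=
  (Measure.pi fun _ : Fin m => Measure.pi fun _ : Fin n => gaussianReal 0 1 :
    Measure (Fin m → Fin n → ℝ))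

/-- The inner product `⟨X, Y⟩ = trace (Xᵀ Y)` of two matrices. -/
def matInner {m n : ℕ} (X Y : Matrix (Fin m) (Fin n) ℝ) : ℝ :=
  (X.transpose * Y).trace

/-- The Frobenius norm `‖X‖_F = √⟨X, X⟩`. -/
def frobNorm {m n : ℕ} (X : Matrix (Fin m) (Fin n) ℝ) : ℝ :=
  Real.sqrt (matInner X X)

/-- The dual norm `‖X‖_d = sup {⟨Y, X⟩ : ‖Y‖_p = 1}`. -/
def dualNorm {m n : ℕ} (p : Seminorm ℝ (Matrix (Fin m) (Fin n) ℝ))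
    (X : Matrix (Fin m) (Fin n) ℝ) : ℝ :=
  ⨆ Y : {Y : Matrix (Fin m) (Fin n) ℝ // p Y = 1}, matInner Y.1 X

/-- `σ(‖G‖_p) = sup {‖Z‖_F : ‖Z‖_d = 1}`, where `‖·‖_d` is dual to `‖·‖_p`. -/
def normSigma {m n : ℕ} (p : Seminorm ℝ (Matrix (Fin m) (Fin n) ℝ)) : ℝ :=
  ⨆ Z : {Z : Matrix (Fin m) (Fin n) ℝ // dualNorm p Z = 1}, frobNorm Z.1

/-- The linear combination `∑ i, v i • A i` of the matrices `A i`. -/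
def matComb {M m n : ℕ} (v : EuclideanSpace ℝ (Fin M))
    (A : Fin M → Matrix (Fin m) (Fin n) ℝ) : Matrix (Fin m) (Fin n) ℝ :=
  ∑ i, v i • A i

/-- `inf_{‖v‖ = 1} inf_{‖Y‖_b = 1} sup_{‖Z‖_d = 1} ⟨∑ vᵢ Aᵢ, Z⟩ + ⟨∑ vᵢ Bᵢ, Y⟩`, where `‖·‖_d` is
dual to `‖·‖_p`. -/
def infSupFun {M D₁ D₂ : ℕ} (p : Seminorm ℝ (Matrix (Fin D₁) (Fin D₁) ℝ))
    (b : Seminorm ℝ (Matrix (Fin D₂) (Fin D₂) ℝ))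
    (A : Fin M → Matrix (Fin D₁) (Fin D₁) ℝ) (B : Fin M → Matrix (Fin D₂) (Fin D₂) ℝ) : ℝ :=
  ⨅ v : {v : EuclideanSpace ℝ (Fin M) // ‖v‖ = 1},
    ⨅ Y : {Y : Matrix (Fin D₂) (Fin D₂) ℝ // b Y = 1},
      ⨆ Z : {Z : Matrix (Fin D₁) (Fin D₁) ℝ // dualNorm p Z = 1},
        (matInner (matComb v.1 A) Z.1 + matInner (matComb v.1 B) Y.1)

/-- `sup_{‖v‖ = 1} sup_{‖Y‖_b = 1} s ⟨g, v⟩ + ⟨∑ vᵢ Bᵢ, Y⟩`. -/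
def supSupFun {M D₂ : ℕ} (s : ℝ) (b : Seminorm ℝ (Matrix (Fin D₂) (Fin D₂) ℝ))
    (g : EuclideanSpace ℝ (Fin M)) (B : Fin M → Matrix (Fin D₂) (Fin D₂) ℝ) : ℝ :=
  ⨆ v : {v : EuclideanSpace ℝ (Fin M) // ‖v‖ = 1},
    ⨆ Y : {Y : Matrix (Fin D₂) (Fin D₂) ℝ // b Y = 1},
      (s * inner ℝ g v.1 + matInner (matComb v.1 B) Y.1)

end

/-! This is Gordon's form of Chevet's inequality. Freeze the matrices `B` that stand for $G'_i$,
write $\sigma$ for `normSigma p`, and compare two centred Gaussian processes indexed by a row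
$u=(v,Y)$ and a column $Z$: $\langle\sum v_iG_i,Z\rangle+\sigma\gamma$, with $\gamma$ an extra
independent scalar Gaussian, and $\langle G_0,Z\rangle+\sigma\langle g,v\rangle$. Their covariances
differ by $(1-\langle v,v'\rangle)(\sigma^2-\langle Z,Z'\rangle)$. This is nonnegative because
$v,v'$ are unit vectors and $\langle Z,Z'\rangle\le\|Z\|_F\|Z'\|_F\le\sigma^2$, and it vanishes
within a row. Gordon's theorem then compares the expected min-max values, also after adding the row
shift $\langle\sum v_iB_i,Y\rangle$. The scalar $\gamma$ has mean zero and drops out; on the other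
side the supremum over $Z$ is $\|G_0\|_p$ by duality, and what remains is an infimum over $(v,Y)$.
This gives `chevet_finite` for finite index sets.

Gordon's inequality (`integral_ciInf_ciSup_le_of_covariance_le`) follows from Kahane's
(`integral_le_integral_of_covariance_le`) applied to a smoothed indicator of the event that the
min-max exceeds a level. Kahane's inequality comes from a Lindeberg-type exchange: one law is traded
for the other in $n$ steps of variance $1/n$, each with a Taylor error of order $n^{-3/2}$, so the
total error tends to zero.

Finite nets carry the bound to the full spheres, with an error linear in the mesh. Finally $B$ is
integrated out, and the invariance of the law of $(g,B)$ under negation turns the infimum into minus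
a supremum. -/

/-! ### Functions with uniform second order Taylor expansions. -/

/-- A bounded function with uniformly bounded second order Taylor expansions at every point, whose
remainder is uniformly of third order. -/
def HasUniformTaylor {E : Type*} [NormedAddCommGroup E] [NormedSpace ℝ E] (F : E → ℝ) : Prop :=
  ∃ C : ℝ, 0 ≤ C ∧ ∀ w, ∃ (L : E →L[ℝ] ℝ) (Q : E →L[ℝ] E →L[ℝ] ℝ),
    |F w| ≤ C ∧ (∀ z, |L z| ≤ C * ‖z‖) ∧ (∀ z, |Q z z| ≤ C * ‖z‖ ^ 2) ∧
      ∀ z, |F (w + z) - F w - L z - Q z z| ≤ C * ‖z‖ ^ 3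

namespace HasUniformTaylor

variable {E : Type*} [NormedAddCommGroup E] [NormedSpace ℝ E] {F G : E → ℝ}

lemma const (c : ℝ) : HasUniformTaylor fun _ : E => c :=
  ⟨|c|, abs_nonneg c, fun w => ⟨0, 0, le_rfl, fun z => by simp; positivity,
    fun z => by simp; positivity, fun z => by simp; positivity⟩⟩

lemma const_sub (hF : HasUniformTaylor F) (c : ℝ) : HasUniformTaylor fun x => c - F x := by
  obtain ⟨C, hC, h⟩ := hF
  refine ⟨|c| + C, by positivity, fun w => ?_⟩
  obtain ⟨L, Q, h0, h1, h2, h3⟩ := h w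
  have hc := abs_nonneg c
  refine ⟨-L, -Q, ?_, fun z => ?_, fun z => ?_, fun z => ?_⟩
  · exact (abs_sub _ _).trans (by linarith)
  · simp only [_root_.neg_apply, abs_neg]
    exact (h1 z).trans (by gcongr; linarith)
  · simp only [_root_.neg_apply, abs_neg]
    exact (h2 z).trans (by gcongr; linarith)
  · have e : c - F (w + z) - (c - F w) - (-L) z - (-Q) z z
        = -(F (w + z) - F w - L z - Q z z) := by simp; ring
    rw [e, abs_neg]
    refine (h3 z).trans ?_
    gcongr
    linarith

lemma comp_clm {E' : Type*} [NormedAddCommGroup E'] [NormedSpace ℝ E'] (hF : HasUniformTaylor F)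
    (T : E' →L[ℝ] E) : HasUniformTaylor fun x => F (T x) := by
  obtain ⟨C, hC, h⟩ := hF
  refine ⟨C + C * ‖T‖ + C * ‖T‖ ^ 2 + C * ‖T‖ ^ 3, by positivity, fun w => ?_⟩
  obtain ⟨L, Q, h0, h1, h2, h3⟩ := h (T w)
  have p1 : 0 ≤ C * ‖T‖ := by positivity
  have p2 : 0 ≤ C * ‖T‖ ^ 2 := by positivity
  have p3 : 0 ≤ C * ‖T‖ ^ 3 := by positivity
  refine ⟨L.comp T, Q.bilinearComp T T, by linarith, fun z => ?_, fun z => ?_, fun z => ?_⟩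
  · calc |L (T z)| ≤ C * (‖T‖ * ‖z‖) := (h1 _).trans (by gcongr; exact T.le_opNorm _)
      _ = C * ‖T‖ * ‖z‖ := by ring
      _ ≤ _ := by gcongr; linarith
  · calc |Q (T z) (T z)| ≤ C * (‖T‖ * ‖z‖) ^ 2 := (h2 _).trans (by gcongr; exact T.le_opNorm _)
      _ = C * ‖T‖ ^ 2 * ‖z‖ ^ 2 := by ring
      _ ≤ _ := by gcongr; linarith
  · have := h3 (T z)
    simp only [map_add, ContinuousLinearMap.comp_apply, ContinuousLinearMap.bilinearComp_apply]
    refine this.trans ?_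
    calc C * ‖T z‖ ^ 3 ≤ C * (‖T‖ * ‖z‖) ^ 3 := by gcongr; exact T.le_opNorm _
      _ = C * ‖T‖ ^ 3 * ‖z‖ ^ 3 := by ring
      _ ≤ _ := by gcongr; linarith

/-- The quadratic part of the product contains `L.smulRight L'`, which is not symmetric. Symmetry of
`Q` is therefore never demanded, and `Q` already includes the factor one half of the second
derivative. -/
lemma mul (hF : HasUniformTaylor F) (hG : HasUniformTaylor G) :
    HasUniformTaylor fun x => F x * G x := by
  obtain ⟨A, hA, h⟩ := hF
  obtain ⟨B, hB, k⟩ := hG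
  have hAB : 0 ≤ A * B := by positivity
  refine ⟨7 * (A * B), by positivity, fun w => ?_⟩
  obtain ⟨L, Q, h0, h1, h2, h3⟩ := h w
  obtain ⟨L', Q', k0, k1, k2, k3⟩ := k w
  have hb : ∀ x, |F x| ≤ A := fun x => by obtain ⟨_, _, h, _⟩ := h x; exact h
  have kb : ∀ x, |G x| ≤ B := fun x => by obtain ⟨_, _, h, _⟩ := k x; exact h
  have mb : ∀ {a b s t : ℝ}, |a| ≤ s → |b| ≤ t → |a * b| ≤ s * t := fun ha hb => by
    rw [abs_mul]; exact mul_le_mul ha hb (abs_nonneg _) ((abs_nonneg _).trans ha)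
  have e0 : |F w * G w| ≤ 7 * (A * B) := (mb h0 k0).trans (by linarith)
  refine ⟨F w • L' + G w • L, F w • Q' + G w • Q + L.smulRight L', e0, fun z => ?_, fun z => ?_,
    fun z => ?_⟩
  · have e1 := mb h0 (k1 z)
    have e2 := mb k0 (h1 z)
    have e3 : 0 ≤ A * B * ‖z‖ := by positivity
    simp only [_root_.add_apply, _root_.smul_apply, smul_eq_mul]
    exact (abs_add_le _ _).trans (by linarith)
  · have e1 := mb h0 (k2 z)
    have e2 := mb k0 (h2 z)
    have e3 := mb (h1 z) (k1 z)
    have e4 : 0 ≤ A * B * ‖z‖ ^ 2 := by positivity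
    simp only [_root_.add_apply, _root_.smul_apply, smul_eq_mul,
      ContinuousLinearMap.smulRight_apply]
    exact (abs_add_three _ _ _).trans (by linarith)
  · set n := ‖z‖ with hn
    have n0 : 0 ≤ n := norm_nonneg z
    have l1 := h1 z
    have l2 := k1 z
    have q1 := h2 z
    have q2 := k2 z
    rw [← hn] at l1 l2 q1 q2
    have r1 := h3 z
    have r2 := k3 z
    simp only [_root_.add_apply, _root_.smul_apply, smul_eq_mul,
      ContinuousLinearMap.smulRight_apply]
    have f1 := hb (w + z)
    have g1 := kb (w + z)
    generalize F (w + z) = f' at *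
    generalize G (w + z) = g' at *
    generalize F w = f at *
    generalize G w = g at *
    generalize L z = l at *
    generalize L' z = l' at *
    generalize Q z z = q at *
    generalize Q' z z = q' at *
    -- For small increments the two expansions are multiplied out; for large ones every term is
    -- bounded separately and absorbed into $n^3$. Both regimes total $7AB$: $1+3+1+1+1$ in the
    -- first, seven terms of size at most $AB\,n^3$ in the second.
    rcases le_total n 1 with h1n | h1n
    · have n2 : n ^ 2 ≤ 1 := by nlinarith
      have s : |f + l + q| ≤ 3 * A := by
        refine (abs_add_three f l q).trans ?_
        nlinarith
      have t1 := mb r1 g1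
      have t2 := mb s r2
      have t3 := mb l1 q2
      have t4 := mb q1 l2
      have t5 := mb q1 q2
      have e : f' * g' - f * g - (f * l' + g * l) - (f * q' + g * q + l * l')
          = (f' - f - l - q) * g' + (f + l + q) * (g' - g - l' - q') + l * q' + q * l'
            + q * q' := by
        ring
      rw [e]
      have n4 : A * n ^ 2 * (B * n ^ 2) ≤ A * B * n ^ 3 := by
        have : n ^ 4 ≤ n ^ 3 := pow_le_pow_of_le_one n0 h1n (by norm_num)
        nlinarith
      refine (abs_add_le _ _).trans ?_
      have := (abs_add_le ((f' - f - l - q) * g' + (f + l + q) * (g' - g - l' - q') + l * q')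
        (q * l'))
      have := abs_add_three ((f' - f - l - q) * g') ((f + l + q) * (g' - g - l' - q')) (l * q')
      nlinarith
    · have t1 := mb f1 g1
      have t2 := mb h0 k0
      have t3 := mb h0 l2
      have t4 := mb k0 l1
      have t5 := mb h0 q2
      have t6 := mb k0 q1
      have t7 := mb l1 l2
      have m0 : A * B ≤ A * B * n ^ 3 := le_mul_of_one_le_right hAB (one_le_pow₀ h1n)
      have m1 : A * B * n ≤ A * B * n ^ 3 := by gcongr; exact le_self_pow₀ h1n (by norm_num)
      have m2 : A * B * n ^ 2 ≤ A * B * n ^ 3 := by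
        gcongr
        · norm_num
      rw [abs_le] at *
      constructor <;> nlinarith

lemma prod {ι : Type*} (s : Finset ι) {f : ι → E → ℝ} (hf : ∀ i ∈ s, HasUniformTaylor (f i)) :
    HasUniformTaylor fun x => ∏ i ∈ s, f i x := by
  classical
  induction s using Finset.induction_on with
  | empty => simpa using const 1
  | insert a s ha ih =>
    simp only [Finset.prod_insert ha]
    exact (hf a (by simp)).mul (ih fun i hi => hf i (by simp [hi]))

end HasUniformTaylor

/-- The derivative is continuous on the compact interval $[0,1]$, and the function is locally
constant outside it. -/
lemma Real.iteratedDeriv_smoothTransition_bounded (k : ℕ) :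
    ∃ C, 0 ≤ C ∧ ∀ x, |iteratedDeriv k Real.smoothTransition x| ≤ C := by
  have hc : Continuous (iteratedDeriv k Real.smoothTransition) :=
    (Real.smoothTransition.contDiff (n := k)).continuous_iteratedDeriv' k
  obtain ⟨C, hC⟩ := (isCompact_Icc (a := (0 : ℝ)) (b := 1)).exists_bound_of_continuousOn
    hc.continuousOn
  refine ⟨max C 1, by positivity, fun x => ?_⟩
  by_cases hx : x ∈ Set.Icc (0 : ℝ) 1
  · exact (hC x hx).trans (le_max_left _ _)
  · have hb : ∀ c : ℝ, |c| ≤ 1 → Real.smoothTransition =ᶠ[nhds x] (fun _ => c) →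
        |iteratedDeriv k Real.smoothTransition x| ≤ max C 1 := fun c hc h => by
      rw [h.iteratedDeriv_eq, iteratedDeriv_const]
      split_ifs
      · exact hc.trans (le_max_right _ _)
      · simp
    rw [Set.mem_Icc, not_and_or, not_le, not_le] at hx
    rcases hx with hx | hx
    · refine hb 0 (by simp) ?_
      filter_upwards [gt_mem_nhds hx] with y hy
      exact Real.smoothTransition.zero_of_nonpos hy.le
    · refine hb 1 (by simp) ?_
      filter_upwards [lt_mem_nhds hx] with y hy
      exact Real.smoothTransition.one_of_one_le hy.le

lemma HasUniformTaylor.smoothTransition_comp_affine (a b : ℝ) :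
    HasUniformTaylor fun x : ℝ => Real.smoothTransition (a * x + b) := by
  obtain ⟨C1, hC1, h1⟩ := Real.iteratedDeriv_smoothTransition_bounded 1
  obtain ⟨C2, hC2, h2⟩ := Real.iteratedDeriv_smoothTransition_bounded 2
  obtain ⟨C3, hC3, h3⟩ := Real.iteratedDeriv_smoothTransition_bounded 3
  have key : HasUniformTaylor Real.smoothTransition := by
    refine ⟨1 + C1 + C2 + C3, by positivity, fun w => ⟨
      (iteratedDeriv 1 Real.smoothTransition w) • ContinuousLinearMap.id ℝ ℝ,
      (iteratedDeriv 2 Real.smoothTransition w / 2) • ContinuousLinearMap.mul ℝ ℝ,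
      ?_, fun z => ?_, fun z => ?_, fun z => ?_⟩⟩
    · rw [abs_of_nonneg (Real.smoothTransition.nonneg _)]
      linarith [Real.smoothTransition.le_one w]
    · simp only [_root_.smul_apply, smul_eq_mul, abs_mul, ContinuousLinearMap.id_apply]
      rw [Real.norm_eq_abs]
      gcongr
      linarith [h1 w]
    · simp only [_root_.smul_apply, smul_eq_mul, abs_mul, ContinuousLinearMap.mul_apply', abs_div,
        abs_two]
      rw [Real.norm_eq_abs, pow_two]
      gcongr
      linarith [h2 w, abs_nonneg (iteratedDeriv 2 Real.smoothTransition w)]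
    -- Taylor's formula with integral remainder; the bound on the third derivative controls the
    -- integral uniformly in `w`.
    · have ht := map_add_eq_sum_add_integral_iteratedFDeriv (f := Real.smoothTransition) (n := 2)
        (x := w) (y := z) (fun t _ => Real.smoothTransition.contDiff.contDiffAt)
      have hz : ∀ (k : ℕ) (x : ℝ), iteratedFDeriv ℝ k Real.smoothTransition x (fun _ => z)
          = z ^ k * iteratedDeriv k Real.smoothTransition x := fun k x => by
        rw [iteratedFDeriv_apply_eq_iteratedDeriv_mul_prod]
        simp
      simp only [hz, Finset.sum_range_succ, Finset.sum_range_zero] at ht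
      have hI : ‖∫ t in (0 : ℝ)..1, (1 - t) ^ 2 • (z ^ (2 + 1) *
          iteratedDeriv (2 + 1) Real.smoothTransition (w + t • z))‖ ≤ |z| ^ 3 * C3 * |1 - 0| := by
        refine intervalIntegral.norm_integral_le_of_norm_le_const fun t ht => ?_
        rw [Set.uIoc_of_le zero_le_one] at ht
        rw [smul_eq_mul, norm_mul, norm_mul, Real.norm_eq_abs, Real.norm_eq_abs, Real.norm_eq_abs,
          abs_pow, abs_pow]
        have : |1 - t| ^ 2 ≤ 1 := pow_le_one₀ (abs_nonneg _)
          (by rw [abs_le]; constructor <;> linarith [ht.1, ht.2])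
        calc _ ≤ 1 * (|z| ^ (2 + 1) * C3) := by gcongr; exact h3 _
          _ = _ := by norm_num
      generalize (∫ t in (0 : ℝ)..1, (1 - t) ^ 2 • (z ^ (2 + 1) *
          iteratedDeriv (2 + 1) Real.smoothTransition (w + t • z))) = I at *
      have e : Real.smoothTransition (w + z) - Real.smoothTransition w
          - (iteratedDeriv 1 Real.smoothTransition w • ContinuousLinearMap.id ℝ ℝ) z
          - ((iteratedDeriv 2 Real.smoothTransition w / 2) • ContinuousLinearMap.mul ℝ ℝ) z z
          = 2⁻¹ * I := by
        rw [ht]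
        simp [Nat.factorial]
        ring
      rw [e, abs_mul, Real.norm_eq_abs I] at *
      rw [Real.norm_eq_abs]
      norm_num at hI ⊢
      have : 0 ≤ |z| ^ 3 := by positivity
      nlinarith
  obtain ⟨C, hC, h⟩ := key
  have hk : HasUniformTaylor fun x : ℝ => Real.smoothTransition (x + b) :=
    ⟨C, hC, fun w => by
      obtain ⟨L, Q, k0, k1, k2, k3⟩ := h (w + b)
      exact ⟨L, Q, k0, k1, k2, fun z => by simpa [add_right_comm] using k3 z⟩⟩
  simpa using hk.comp_clm (a • ContinuousLinearMap.id ℝ ℝ)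

/-! ### Comparison of Gaussian means by exchanging small variances. -/

section GaussianComparison

variable {E : Type*} [NormedAddCommGroup E] [NormedSpace ℝ E] [CompleteSpace E]
  [SecondCountableTopology E] [MeasurableSpace E] [BorelSpace E]

/-- Rotation invariance of $\mu\otimes\mu$: at the angle with cosine $a/c$ and sine $b/c$, the first
coordinate scaled by $c$ becomes $ax+by$. -/
lemma ProbabilityTheory.IsGaussian.integral_smul_eq_integral_integral {μ : Measure E}
    [IsGaussian μ] (hμ : μ[id] = 0) {f : E → ℝ} (hf : Continuous f) {C : ℝ} (hC : ∀ x, |f x| ≤ C)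
    {a b c : ℝ} (ha : 0 ≤ a) (hb : 0 ≤ b) (hc : 0 < c) (h : a ^ 2 + b ^ 2 = c ^ 2) :
    ∫ x, f (c • x) ∂μ = ∫ x, ∫ y, f (a • x + b • y) ∂μ ∂μ := by
  set θ := Real.arcsin (b / c)
  have hbc : b / c ≤ 1 := by rw [div_le_one hc]; nlinarith
  have hs : Real.sin θ = b / c := Real.sin_arcsin (by linarith [div_nonneg hb hc.le]) hbc
  have hcos : Real.cos θ = a / c := by
    rw [Real.cos_arcsin, ← Real.sqrt_sq (div_nonneg ha hc.le)]
    congr 1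
    field_simp
    linarith
  have e := IsGaussian.map_rotation_eq_self hμ θ
  have hfst : (μ.prod μ).map Prod.fst = μ := by simp [Measure.map_fst_prod]
  calc ∫ x, f (c • x) ∂μ = ∫ p, f (c • p.1) ∂(μ.prod μ) := by
        conv_lhs => rw [← hfst]
        rw [integral_map (by fun_prop)]
        exact (by fun_prop : Continuous fun x => f (c • x)).aestronglyMeasurable
    _ = ∫ p, f (a • p.1 + b • p.2) ∂(μ.prod μ) := by
        conv_lhs => rw [← e]
        rw [integral_map (by fun_prop)]
        · refine integral_congr_ae (.of_forall fun p => ?_)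
          simp only [ContinuousLinearMap.rotation_apply, smul_add, smul_smul, hs, hcos]
          rw [mul_div_cancel₀ _ hc.ne', mul_div_cancel₀ _ hc.ne']
        · exact (by fun_prop : Continuous fun p : E × E => f (c • p.1)).aestronglyMeasurable
    _ = _ := by
        rw [integral_prod]
        exact Integrable.of_bound
          (by fun_prop : Continuous fun p : E × E => f (a • p.1 + b • p.2)).aestronglyMeasurable C
          (.of_forall fun p => hC _)

/-- One exchange step with increment of scale `s`. The constant terms agree, the linear terms
integrate to zero by centring, the quadratic terms are ordered by `hQ`, and only the cubic remainder
is lost. -/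
lemma integral_le_integral_add_of_taylor {μ ν : Measure E} [IsGaussian μ] [IsGaussian ν]
    (hμ : μ[id] = 0) (hν : ν[id] = 0) {F : E → ℝ} (hF : Continuous F) {C : ℝ}
    (hFC : ∀ x, |F x| ≤ C) {w : E} {L : E →L[ℝ] ℝ} {Q : E →L[ℝ] E →L[ℝ] ℝ}
    (hQC : ∀ z, |Q z z| ≤ C * ‖z‖ ^ 2)
    (hw : ∀ z, |F (w + z) - F w - L z - Q z z| ≤ C * ‖z‖ ^ 3)
    (hQ : ∫ x, Q x x ∂ν ≤ ∫ x, Q x x ∂μ) {s : ℝ} (hs : 0 ≤ s) :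
    ∫ x, F (w + s • x) ∂ν ≤ ∫ x, F (w + s • x) ∂μ
      + s ^ 3 * (C * ∫ x, ‖x‖ ^ 3 ∂μ + C * ∫ x, ‖x‖ ^ 3 ∂ν) := by
  have main : ∀ (ρ : Measure E) [IsGaussian ρ], ρ[id] = 0 →
      |∫ x, F (w + s • x) ∂ρ - (F w + s ^ 2 * ∫ x, Q x x ∂ρ)| ≤ s ^ 3 * (C * ∫ x, ‖x‖ ^ 3 ∂ρ) := by
    intro ρ _ hρ
    have i1 : Integrable (fun x => F (w + s • x)) ρ := Integrable.of_bound
      (by fun_prop : Continuous fun x => F (w + s • x)).aestronglyMeasurable C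
      (.of_forall fun p => hFC _)
    have n3 : Integrable (fun x => ‖x‖ ^ 3) ρ :=
      (IsGaussian.memLp_id ρ 3 (by norm_num)).integrable_norm_pow (by norm_num)
    have n2 : Integrable (fun x => ‖x‖ ^ 2) ρ :=
      (IsGaussian.memLp_id ρ 2 (by norm_num)).integrable_norm_pow (by norm_num)
    have i2 : Integrable (fun x => Q x x) ρ := (n2.const_mul C).mono'
      (by fun_prop : Continuous fun x => Q x x).aestronglyMeasurable (.of_forall hQC)
    have i3 : Integrable (fun x => L x) ρ := IsGaussian.integrable_dual ρ L
    have hL : ∫ x, L x ∂ρ = 0 := by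
      rw [IsGaussian.integral_dual]; simp only [id_eq] at hρ; simp [hρ]
    have e : ∫ x, F (w + s • x) ∂ρ - (F w + s ^ 2 * ∫ x, Q x x ∂ρ)
        = ∫ x, (F (w + s • x) - F w - L (s • x) - Q (s • x) (s • x)) ∂ρ := by
      have : ∀ x, F (w + s • x) - F w - L (s • x) - Q (s • x) (s • x)
          = F (w + s • x) - F w - s * L x - s ^ 2 * Q x x := fun x => by simp; ring
      simp_rw [this]
      have j1 : Integrable (fun x => F (w + s • x) - F w) ρ := i1.sub (integrable_const _)
      have j2 : Integrable (fun x => F (w + s • x) - F w - s * L x) ρ := j1.sub (i3.const_mul _)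
      rw [integral_sub j2 (i2.const_mul _), integral_sub j1 (i3.const_mul _),
        integral_sub i1 (integrable_const _), integral_const_mul, integral_const_mul, hL]
      simp
      ring
    rw [e, ← integral_const_mul, ← integral_const_mul]
    rw [← Real.norm_eq_abs]
    refine norm_integral_le_of_norm_le ((n3.const_mul C).const_mul (s ^ 3))
      (.of_forall fun x => ?_)
    refine (hw (s • x)).trans (le_of_eq ?_)
    rw [norm_smul, Real.norm_of_nonneg hs]
    ring
  have h1 := (abs_le.1 (main μ hμ)).1
  have h2 := (abs_le.1 (main ν hν)).2
  have : s ^ 2 * ∫ x, Q x x ∂ν ≤ s ^ 2 * ∫ x, Q x x ∂μ := by gcongr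
  linarith

/-- Comparison of Gaussian expectations: if `F` has uniform second order Taylor expansions whose
quadratic parts have a smaller `ν`-mean than `μ`-mean, then `F` has a smaller `ν`-mean than
`μ`-mean. -/
theorem integral_le_integral_of_taylor {μ ν : Measure E} [IsGaussian μ] [IsGaussian ν]
    (hμ : μ[id] = 0) (hν : ν[id] = 0) {F : E → ℝ} (hF : Continuous F) {C : ℝ} (hC : 0 ≤ C)
    (hFC : ∀ x, |F x| ≤ C)
    (hT : ∀ w, ∃ (L : E →L[ℝ] ℝ) (Q : E →L[ℝ] E →L[ℝ] ℝ), (∀ z, |Q z z| ≤ C * ‖z‖ ^ 2) ∧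
      (∀ z, |F (w + z) - F w - L z - Q z z| ≤ C * ‖z‖ ^ 3) ∧
      ∫ x, Q x x ∂ν ≤ ∫ x, Q x x ∂μ) :
    ∫ x, F x ∂ν ≤ ∫ x, F x ∂μ := by
  set K := C * ∫ x, ‖x‖ ^ 3 ∂μ + C * ∫ x, ‖x‖ ^ 3 ∂ν with hK
  have hK0 : 0 ≤ K := by positivity
  have key : ∀ n : ℕ, 0 < n → ∫ x, F x ∂ν ≤ ∫ x, F x ∂μ + √(1 / n) * K := by
    intro n hn
    have hn' : (0 : ℝ) < n := by exact_mod_cast hn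
    set s := √(1 / n) with hs
    have hs0 : 0 ≤ s := Real.sqrt_nonneg _
    have hs2 : s ^ 2 = 1 / n := Real.sq_sqrt (by positivity)
    -- The hybrid with a share $k/n$ of the variance from `μ` and the rest from `ν`. `Ψ k` and `Ψ (k
    -- + 1)` have the common base point $ax+b'y$ and differ only in whether the last increment of
    -- variance $1/n$ has law `ν` or `μ`.
    set Ψ : ℕ → ℝ := fun k => ∫ x, ∫ y, F (√(k / n) • x + √((n - k) / n) • y) ∂ν ∂μ with hΨ
    have step : ∀ k < n, Ψ k ≤ Ψ (k + 1) + s ^ 3 * K := by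
      intro k hk
      have hk' : (k : ℝ) + 1 ≤ n := by exact_mod_cast hk
      set a := √(k / n) with ha
      set b' := √((n - (k + 1)) / n) with hb'
      have ha2 : a ^ 2 = k / n := Real.sq_sqrt (by positivity)
      have hb2 : b' ^ 2 = (n - (k + 1)) / n :=
        Real.sq_sqrt (div_nonneg (by linarith) hn'.le)
      have bd : ∀ (ρ : Measure E) [IsGaussian ρ], Integrable
          (fun p : E × E => ∫ z, F ((a • p.1 + b' • p.2) + s • z) ∂ρ) (μ.prod ν) := fun ρ _ =>
        (Integrable.of_bound (by fun_prop : Continuous fun p : (E × E) × E =>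
          F ((a • p.1.1 + b' • p.1.2) + s • p.2)).aestronglyMeasurable C
          (.of_forall fun p => hFC _) :
            Integrable _ ((μ.prod ν).prod ρ)).integral_prod_left
      have e1 : Ψ k = ∫ p, ∫ z, F ((a • p.1 + b' • p.2) + s • z) ∂ν ∂(μ.prod ν) := by
        rw [integral_prod _ (bd ν)]
        refine integral_congr_ae (.of_forall fun x => ?_)
        have := IsGaussian.integral_smul_eq_integral_integral hν
          (f := fun y => F (a • x + y)) (by fun_prop) (fun _ => hFC _)
          (a := b') (b := s) (c := √((n - k) / n)) (Real.sqrt_nonneg _) hs0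
          (Real.sqrt_pos.2 (div_pos (by linarith) hn'))
          (by rw [hb2, hs2, Real.sq_sqrt (div_nonneg (by linarith) hn'.le)]; field_simp; ring)
        simp only [add_assoc]
        exact this
      have e2 : Ψ (k + 1) = ∫ p, ∫ z, F ((a • p.1 + b' • p.2) + s • z) ∂μ ∂(μ.prod ν) := by
        rw [integral_prod_symm _ (bd μ)]
        simp only [hΨ, Nat.cast_add, Nat.cast_one]
        rw [integral_integral_swap]
        · refine integral_congr_ae (.of_forall fun y => ?_)
          have := IsGaussian.integral_smul_eq_integral_integral hμ
            (f := fun x => F (x + b' • y)) (by fun_prop) (fun _ => hFC _)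
            (a := a) (b := s) (c := √((k + 1) / n)) (Real.sqrt_nonneg _) hs0
            (Real.sqrt_pos.2 (by positivity))
            (by rw [ha2, hs2, Real.sq_sqrt (by positivity)]; field_simp)
          simp only [add_right_comm _ (b' • y)]
          exact this
        · exact Integrable.of_bound (by fun_prop : Continuous
            (fun p : E × E => F (√((k + 1) / n) • p.1 + b' • p.2))).aestronglyMeasurable C
            (.of_forall fun p => hFC _)
      rw [e1, e2, hK]
      calc _ ≤ ∫ p : E × E, (∫ z, F ((a • p.1 + b' • p.2) + s • z) ∂μ + s ^ 3 * K) ∂(μ.prod ν) := by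
            refine integral_mono (bd ν) ((bd μ).add (integrable_const _)) fun p => ?_
            obtain ⟨L, Q, hQ, hw, hQQ⟩ := hT (a • p.1 + b' • p.2)
            exact integral_le_integral_add_of_taylor hμ hν hF hFC hQ hw hQQ hs0
        _ = _ := by rw [integral_add (bd μ) (integrable_const _)]; simp [hK]
    have tot : ∀ k ≤ n, Ψ 0 ≤ Ψ k + k * (s ^ 3 * K) := by
      intro k
      induction k with
      | zero => simp
      | succ k ih =>
        intro hk
        have h1 := ih (by omega)
        have h2 := step k hk
        push_cast
        linarith
    have h0 : Ψ 0 = ∫ x, F x ∂ν := by simp [hΨ, hn'.ne']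
    have h1 : Ψ n = ∫ x, F x ∂μ := by simp [hΨ, hn'.ne']
    have := tot n le_rfl
    rw [h0, h1] at this
    -- The $n$ step errors add up to $n\,s^3K=sK$ since $s^2=1/n$, which tends to zero.
    have e : (n : ℝ) * (s ^ 3 * K) = s * K := by
      have : s ^ 3 = s * (1 / n) := by rw [← hs2]; ring
      rw [this]; field_simp
    linarith
  have lim : Filter.Tendsto (fun n : ℕ => ∫ x, F x ∂μ + √(1 / n) * K) Filter.atTop
      (nhds (∫ x, F x ∂μ + √0 * K)) :=
    ((Real.continuous_sqrt.tendsto _ |>.comp tendsto_one_div_atTop_nhds_zero_nat).mul_const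
      _).const_add _
  rw [Real.sqrt_zero, zero_mul, add_zero] at lim
  exact ge_of_tendsto lim (Filter.eventually_atTop.2 ⟨1, fun n hn => key n hn⟩)

end GaussianComparison

/-! ### Lipschitz bounds for suprema and infima, and Gaussian integrability. -/

section Lipschitz

variable {E : Type*} [NormedAddCommGroup E] {ι : Sort*} [Nonempty ι]

lemma abs_ciSup_sub_ciSup_le {f g : ι → ℝ} (hf : BddAbove (Set.range f))
    (hg : BddAbove (Set.range g)) {r : ℝ} (h : ∀ i, |f i - g i| ≤ r) :
    |(⨆ i, f i) - ⨆ i, g i| ≤ r := by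
  rw [abs_sub_le_iff]
  constructor
  · rw [sub_le_iff_le_add]
    exact ciSup_le fun i => by linarith [le_ciSup hg i, (abs_le.1 (h i)).2]
  · rw [sub_le_iff_le_add]
    exact ciSup_le fun i => by linarith [le_ciSup hf i, (abs_le.1 (h i)).1]

lemma abs_ciInf_sub_ciInf_le {f g : ι → ℝ} (hf : BddBelow (Set.range f))
    (hg : BddBelow (Set.range g)) {r : ℝ} (h : ∀ i, |f i - g i| ≤ r) :
    |(⨅ i, f i) - ⨅ i, g i| ≤ r := by
  rw [abs_sub_le_iff]
  constructor
  · rw [sub_le_comm]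
    exact le_ciInf fun i => by linarith [ciInf_le hf i, (abs_le.1 (h i)).2]
  · rw [sub_le_comm]
    exact le_ciInf fun i => by linarith [ciInf_le hg i, (abs_le.1 (h i)).1]

lemma continuous_of_abs_sub_le {f : E → ℝ} {K : ℝ} (h : ∀ x y, |f x - f y| ≤ K * ‖x - y‖) :
    Continuous f :=
  (LipschitzWith.of_dist_le' (K := K) fun x y => by
    rw [Real.dist_eq, dist_eq_norm]; exact h x y).continuous

lemma ProbabilityTheory.IsGaussian.integrable_of_abs_sub_le [NormedSpace ℝ E] [CompleteSpace E]
    [SecondCountableTopology E] [MeasurableSpace E] [BorelSpace E] {μ : Measure E} [IsGaussian μ]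
    {f : E → ℝ} {K : ℝ} (h : ∀ x y, |f x - f y| ≤ K * ‖x - y‖) : Integrable f μ := by
  refine ((integrable_const |f 0|).add
    ((IsGaussian.integrable_id (μ := μ)).norm.const_mul K)).mono'
    (continuous_of_abs_sub_le h).aestronglyMeasurable (.of_forall fun x => ?_)
  have := h x 0
  rw [sub_zero] at this
  rw [Real.norm_eq_abs]
  simp only [Pi.add_apply, id_eq]
  linarith [abs_sub_abs_le_abs_sub (f x) (f 0)]

end Lipschitz

/-! ### Layer-cake comparison of means. -/

lemma lintegral_ofReal_eq_lintegral_meas_lt {α : Type*} [MeasurableSpace α] (μ : Measure α)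
    {X : α → ℝ} (hX : Measurable X) :
    ∫⁻ x, ENNReal.ofReal (X x) ∂μ = ∫⁻ t in Set.Ioi (0 : ℝ), μ {x | t < X x} := by
  have := lintegral_eq_lintegral_meas_lt μ (f := fun y => max (X y) 0)
    (.of_forall fun y => le_max_right _ _) (hX.max measurable_const).aemeasurable
  simp only [ENNReal.ofReal_max, ENNReal.ofReal_zero, zero_le, max_eq_left] at this
  rw [this]
  refine setLIntegral_congr_fun measurableSet_Ioi fun t ht => ?_
  have ht' : ¬ t < 0 := not_lt.2 (le_of_lt ht)
  simp [ht']

lemma lintegral_ofReal_neg_eq_lintegral_meas_lt {α : Type*} [MeasurableSpace α] (μ : Measure α)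
    [IsProbabilityMeasure μ] {X : α → ℝ} (hX : Measurable X) :
    ∫⁻ x, ENNReal.ofReal (-X x) ∂μ = ∫⁻ t in Set.Ioi (0 : ℝ), (1 - μ {x | -t < X x}) := by
  have := lintegral_eq_lintegral_meas_le μ (f := fun y => max (-X y) 0)
    (.of_forall fun y => le_max_right _ _) (hX.neg.max measurable_const).aemeasurable
  simp only [ENNReal.ofReal_max, ENNReal.ofReal_zero, zero_le, max_eq_left] at this
  rw [this]
  refine setLIntegral_congr_fun measurableSet_Ioi fun t ht => ?_
  have ht' : ¬ t ≤ 0 := not_le.2 ht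
  rw [← prob_compl_eq_one_sub (measurableSet_lt measurable_const hX)]
  congr 1
  ext y
  simp [ht', le_neg]

/-- Layer cake on positive and negative parts separately: larger tails enlarge the former and shrink
the latter. -/
lemma integral_le_integral_of_forall_measure_lt_le {α β : Type*} [MeasurableSpace α]
    [MeasurableSpace β] {μ : Measure α} {ν : Measure β} [IsProbabilityMeasure μ]
    [IsProbabilityMeasure ν] {X : α → ℝ} {Y : β → ℝ} (hXm : Measurable X) (hYm : Measurable Y)
    (hX : Integrable X μ) (hY : Integrable Y ν)
    (h : ∀ t, ν {y | t < Y y} ≤ μ {x | t < X x}) : ∫ y, Y y ∂ν ≤ ∫ x, X x ∂μ := by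
  have hpos : ∫⁻ y, ENNReal.ofReal (Y y) ∂ν ≤ ∫⁻ x, ENNReal.ofReal (X x) ∂μ := by
    rw [lintegral_ofReal_eq_lintegral_meas_lt ν hYm, lintegral_ofReal_eq_lintegral_meas_lt μ hXm]
    exact lintegral_mono fun t => h t
  have hneg : ∫⁻ x, ENNReal.ofReal (-X x) ∂μ ≤ ∫⁻ y, ENNReal.ofReal (-Y y) ∂ν := by
    rw [lintegral_ofReal_neg_eq_lintegral_meas_lt ν hYm,
      lintegral_ofReal_neg_eq_lintegral_meas_lt μ hXm]
    exact lintegral_mono fun t => tsub_le_tsub_left (h _) _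
  rw [integral_eq_lintegral_pos_part_sub_lintegral_neg_part hX,
    integral_eq_lintegral_pos_part_sub_lintegral_neg_part hY]
  have h1 := ENNReal.toReal_mono (hX.lintegral_lt_top.ne) hpos
  have h2 := ENNReal.toReal_mono (hY.neg.lintegral_lt_top.ne) hneg
  simp only [Pi.neg_apply] at h2
  linarith

/-! ### Kahane's inequality. -/

section Kahane

variable {ι : Type*} [Fintype ι] [DecidableEq ι]

/-- Kahane's comparison inequality for centred Gaussian measures. -/
theorem integral_le_integral_of_covariance_le {μ ν : Measure (ι → ℝ)} [IsGaussian μ]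
    [IsGaussian ν] (hμ : μ[id] = 0) (hν : ν[id] = 0) {F : (ι → ℝ) → ℝ} (hF : Continuous F)
    (hT : HasUniformTaylor F)
    (hle : ∀ i j, cov[fun x => x i, fun x => x j; ν] ≤ cov[fun x => x i, fun x => x j; μ])
    (hmix : ∀ i j, cov[fun x => x i, fun x => x j; ν] ≠ cov[fun x => x i, fun x => x j; μ] →
      ∀ w s, 0 ≤ s → F (w + Pi.single i s) + F (w + Pi.single j s)
        ≤ F (w + (Pi.single i s + Pi.single j s)) + F w) :
    ∫ x, F x ∂ν ≤ ∫ x, F x ∂μ := by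
  obtain ⟨C, hC, h⟩ := hT
  refine integral_le_integral_of_taylor hμ hν hF hC
    (fun x => by obtain ⟨_, _, h, _⟩ := h x; exact h) fun w => ?_
  obtain ⟨L, Q, -, -, hQ, hw⟩ := h w
  refine ⟨L, Q, hQ, hw, ?_⟩
  -- In coordinates the mean of the quadratic part is the sum of `q i j` against the covariances, so
  -- only the sign of `q` where the covariances differ matters.
  set q : ι → ι → ℝ := fun i j => Q (Pi.single i 1) (Pi.single j 1) with hq
  have hsum : ∀ (ρ : Measure (ι → ℝ)) [IsGaussian ρ], ρ[id] = 0 →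
      ∫ x, Q x x ∂ρ = ∑ i, ∑ j, q i j * cov[fun x => x i, fun x => x j; ρ] := by
    intro ρ _ hρ
    have hL2 : ∀ i, MemLp (fun x : ι → ℝ => x i) 2 ρ := fun i =>
      IsGaussian.memLp_dual ρ (ContinuousLinearMap.proj i) 2 (by norm_num)
    have hm : ∀ i, ∫ x, x i ∂ρ = 0 := fun i => by
      have := IsGaussian.integral_dual (μ := ρ) (ContinuousLinearMap.proj (R := ℝ) i)
      simp only [id_eq] at hρ
      simpa [hρ] using this
    have e : ∀ x : ι → ℝ, Q x x = ∑ i, ∑ j, q i j * (x i * x j) := fun x => by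
      conv_lhs => rw [pi_eq_sum_univ' x]
      simp only [map_sum, _root_.sum_apply, map_smul, smul_eq_mul, hq,
        _root_.smul_apply, Finset.mul_sum]
      refine Finset.sum_comm.trans (Finset.sum_congr rfl fun i _ => Finset.sum_congr rfl
        fun j _ => ?_)
      ring
    simp_rw [e]
    have hij : ∀ i j, Integrable (fun x : ι → ℝ => q i j * (x i * x j)) ρ := fun i j =>
      ((hL2 i).integrable_mul (hL2 j)).const_mul _
    rw [integral_finsetSum _ fun i _ => integrable_finsetSum _ fun j _ => hij i j]
    refine Finset.sum_congr rfl fun i _ => ?_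
    rw [integral_finsetSum _ fun j _ => hij i j]
    refine Finset.sum_congr rfl fun j _ => ?_
    rw [integral_const_mul, covariance_eq_sub (hL2 i) (hL2 j), hm i]
    simp
  rw [hsum μ hμ, hsum ν hν]
  set d : ι → ι → ℝ := fun i j =>
    cov[fun x => x i, fun x => x j; μ] - cov[fun x => x i, fun x => x j; ν] with hd
  have hd0 : ∀ i j, 0 ≤ d i j := fun i j => sub_nonneg.2 (hle i j)
  have hds : ∀ i j, d i j = d j i := fun i j => by
    simp only [hd]
    rw [covariance_comm, covariance_comm (μ := ν)]
  have hqd : ∀ i j, 0 ≤ (q i j + q j i) * d i j := fun i j => by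
    by_cases hdz : d i j = 0
    · simp [hdz]
    refine mul_nonneg ?_ (hd0 i j)
    have hm := hmix i j fun h => hdz (sub_eq_zero.2 h.symm)
    set ei : ι → ℝ := Pi.single i 1
    set ej : ι → ℝ := Pi.single j 1
    set K : ℝ := C * ‖ei + ej‖ ^ 3 + C * ‖ei‖ ^ 3 + C * ‖ej‖ ^ 3
    have hsi : ∀ (s : ℝ) (k : ι), (Pi.single k s : ι → ℝ) = s • Pi.single k 1 := fun s k => by
      rw [← Pi.single_smul, smul_eq_mul, mul_one]
    -- In the mixed difference the constant and linear terms cancel, leaving $s^2(q_{ij}+q_{ji})$ up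
    -- to $Ks^3$. Dividing by $s^2$ and letting $s\to0$ gives the sign.
    have key : ∀ s : ℝ, 0 < s → -(K * s) ≤ q i j + q j i := fun s hs => by
      have h0 := hm w s hs.le
      rw [hsi s i, hsi s j, ← smul_add] at h0
      have h1 := (abs_le.1 (hw (s • (ei + ej)))).2
      have h2 := (abs_le.1 (hw (s • ei))).1
      have h3 := (abs_le.1 (hw (s • ej))).1
      simp only [norm_smul, Real.norm_of_nonneg hs.le, map_smul, map_add,
        _root_.smul_apply, _root_.add_apply, smul_eq_mul] at h1 h2 h3
      have : 0 ≤ s ^ 2 * (q i j + q j i + K * s) := by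
        simp only [hq, K]
        linarith
      have := nonneg_of_mul_nonneg_right this (by positivity)
      linarith
    have lim : Filter.Tendsto (fun s : ℝ => -(K * s)) (nhdsWithin 0 (Set.Ioi 0)) (nhds 0) := by
      have : Continuous fun s : ℝ => -(K * s) := by fun_prop
      simpa using (this.tendsto 0).mono_left nhdsWithin_le_nhds
    exact le_of_tendsto lim (by filter_upwards [self_mem_nhdsWithin] with s hs using key s hs)
  have h2 : 0 ≤ ∑ i, ∑ j, (q i j + q j i) * d i j :=
    Finset.sum_nonneg fun i _ => Finset.sum_nonneg fun j _ => hqd i j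
  -- Only the symmetrised coefficients have a known sign; the symmetry of `d` makes that sufficient.
  have e1 : ∑ i, ∑ j, (q i j + q j i) * d i j = 2 * ∑ i, ∑ j, q i j * d i j := by
    simp_rw [add_mul, Finset.sum_add_distrib]
    rw [Finset.sum_comm (f := fun i j => q j i * d i j)]
    rw [two_mul]
    congr 1
    refine Finset.sum_congr rfl fun i _ => Finset.sum_congr rfl fun j _ => ?_
    rw [hds]
  have e2 : ∑ i, ∑ j, q i j * d i j = ∑ i, ∑ j, q i j * cov[fun x => x i, fun x => x j; μ]
      - ∑ i, ∑ j, q i j * cov[fun x => x i, fun x => x j; ν] := by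
    simp_rw [← Finset.sum_sub_distrib, hd, mul_sub]
  linarith

end Kahane

/-! ### Gordon's min-max inequality. -/

section Gordon

/-- A smoothed indicator of the event that every row `u` of `x` has an entry with
`a * x (u, k) + b u` positive. -/
noncomputable def softMinMax {ι κ : Type*} [Fintype ι] [Fintype κ] (a : ℝ) (b : ι → ℝ)
    (x : ι × κ → ℝ) : ℝ :=
  ∏ u, (1 - ∏ k, (1 - Real.smoothTransition (a * x (u, k) + b u)))

lemma prod_one_sub_smoothTransition_mem {κ : Type*} [Fintype κ] (t : κ → ℝ) :
    ∏ k, (1 - Real.smoothTransition (t k)) ∈ Set.Icc (0 : ℝ) 1 :=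
  ⟨Finset.prod_nonneg fun _ _ => sub_nonneg.2 (Real.smoothTransition.le_one _),
    Finset.prod_le_one (fun _ _ => sub_nonneg.2 (Real.smoothTransition.le_one _))
      fun _ _ => sub_le_self _ (Real.smoothTransition.nonneg _)⟩

variable {ι κ : Type*} [Fintype ι] [Fintype κ]

lemma hasUniformTaylor_softMinMax (a : ℝ) (b : ι → ℝ) :
    HasUniformTaylor (softMinMax (κ := κ) a b) := by
  refine HasUniformTaylor.prod _ fun u _ => HasUniformTaylor.const_sub
    (HasUniformTaylor.prod _ fun k _ => HasUniformTaylor.const_sub ?_ 1) 1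
  exact (HasUniformTaylor.smoothTransition_comp_affine a (b u)).comp_clm
    (ContinuousLinearMap.proj (R := ℝ) (φ := fun _ : ι × κ => ℝ) (u, k))

lemma continuous_softMinMax (a : ℝ) (b : ι → ℝ) : Continuous (softMinMax (κ := κ) a b) := by
  have := Real.smoothTransition.continuous
  unfold softMinMax
  fun_prop

lemma softMinMax_nonneg (a : ℝ) (b : ι → ℝ) (x : ι × κ → ℝ) : 0 ≤ softMinMax a b x :=
  Finset.prod_nonneg fun _ _ => sub_nonneg.2 (prod_one_sub_smoothTransition_mem _).2

lemma softMinMax_le_one (a : ℝ) (b : ι → ℝ) (x : ι × κ → ℝ) : softMinMax a b x ≤ 1 :=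
  Finset.prod_le_one (fun _ _ => sub_nonneg.2 (prod_one_sub_smoothTransition_mem _).2)
    fun _ _ => sub_le_self _ (prod_one_sub_smoothTransition_mem _).1

lemma softMinMax_eq_one {a : ℝ} {b : ι → ℝ} {x : ι × κ → ℝ}
    (h : ∀ u, ∃ k, 1 ≤ a * x (u, k) + b u) : softMinMax a b x = 1 := by
  refine Finset.prod_eq_one fun u _ => ?_
  obtain ⟨k, hk⟩ := h u
  rw [Finset.prod_eq_zero (Finset.mem_univ k), sub_zero]
  rw [Real.smoothTransition.one_of_one_le hk, sub_self]

lemma softMinMax_eq_zero {a : ℝ} {b : ι → ℝ} {x : ι × κ → ℝ}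
    (h : ∃ u, ∀ k, a * x (u, k) + b u ≤ 0) : softMinMax a b x = 0 := by
  obtain ⟨u, hu⟩ := h
  refine Finset.prod_eq_zero (Finset.mem_univ u) ?_
  rw [Finset.prod_eq_one fun k _ => ?_, sub_self]
  rw [Real.smoothTransition.zero_of_nonpos (hu k), sub_zero]

variable [DecidableEq ι] [DecidableEq κ]

/-- Entries in different rows act on different factors, each monotone. The mixed difference is thus
a product of two nonnegative increments and the remaining nonnegative factors. -/
lemma softMinMax_supermodular {a : ℝ} (ha : 0 ≤ a) (b : ι → ℝ) {i j : ι × κ} (hij : i.1 ≠ j.1)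
    (w : ι × κ → ℝ) {s : ℝ} (hs : 0 ≤ s) :
    softMinMax a b (w + Pi.single i s) + softMinMax a b (w + Pi.single j s)
      ≤ softMinMax a b (w + (Pi.single i s + Pi.single j s)) + softMinMax a b w := by
  set φ : ι → (ι × κ → ℝ) → ℝ := fun u x =>
    1 - ∏ k, (1 - Real.smoothTransition (a * x (u, k) + b u)) with hφ
  have hcongr : ∀ u x y, (∀ k, x (u, k) = y (u, k)) → φ u x = φ u y := fun u x y h => by
    simp only [hφ, h]
  have hmono : ∀ u x y, (∀ k, x (u, k) ≤ y (u, k)) → φ u x ≤ φ u y := fun u x y h => by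
    refine sub_le_sub_left (Finset.prod_le_prod
      (fun _ _ => sub_nonneg.2 (Real.smoothTransition.le_one _)) fun k _ => ?_) 1
    exact sub_le_sub_left (Real.smoothTransition.monotone (by have := h k; gcongr)) 1
  have hne : ∀ (p : ι × κ) u, u ≠ p.1 → ∀ k, (Pi.single p s : ι × κ → ℝ) (u, k) = 0 :=
    fun p u hu k => Pi.single_eq_of_ne (fun h => hu (congrArg Prod.fst h)) _
  have hnn : ∀ (p q : ι × κ), 0 ≤ (Pi.single p s : ι × κ → ℝ) q := fun p q =>
    (Pi.single_nonneg.2 hs : (0 : ι × κ → ℝ) ≤ Pi.single p s) q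
  have hprod : ∀ x, softMinMax a b x
      = φ i.1 x * (φ j.1 x * ∏ v ∈ (Finset.univ.erase i.1).erase j.1, φ v x) := fun x => by
    rw [Finset.mul_prod_erase _ (φ · x) (by simp [hij.symm]),
      Finset.mul_prod_erase _ (φ · x) (by simp)]
    rfl
  set R := ∏ v ∈ (Finset.univ.erase i.1).erase j.1, φ v w with hR
  have hR0 : 0 ≤ R :=
    Finset.prod_nonneg fun _ _ => sub_nonneg.2 (prod_one_sub_smoothTransition_mem _).2
  have hrest : ∀ x, (∀ v, v ≠ i.1 → v ≠ j.1 → ∀ k, x (v, k) = 0) →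
      ∏ v ∈ (Finset.univ.erase i.1).erase j.1, φ v (w + x) = R := fun x hx => by
    refine Finset.prod_congr rfl fun v hv => hcongr _ _ _ fun k => ?_
    simp only [Finset.mem_erase, Finset.mem_univ, and_true] at hv
    simp [hx v hv.2 hv.1 k]
  have hi := hne i
  have hj := hne j
  have hi0 := hnn i
  have hj0 := hnn j
  generalize (Pi.single i s : ι × κ → ℝ) = p at *
  generalize (Pi.single j s : ι × κ → ℝ) = q at *
  rw [hprod, hprod, hprod, hprod w, ← hR, hrest p fun v h _ k => hi v h k,
    hrest q fun v _ h k => hj v h k,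
    hrest (p + q) fun v h h' k => by simp [hi v h k, hj v h' k],
    hcongr i.1 (w + q) w fun k => by simp [hj i.1 hij k],
    hcongr j.1 (w + p) w fun k => by simp [hi j.1 hij.symm k],
    hcongr i.1 (w + (p + q)) (w + p) fun k => by simp [hj i.1 hij k],
    hcongr j.1 (w + (p + q)) (w + q) fun k => by simp [hi j.1 hij.symm k]]
  have h1 : φ i.1 w ≤ φ i.1 (w + p) := hmono _ _ _ fun k => by simp [hi0]
  have h2 : φ j.1 w ≤ φ j.1 (w + q) := hmono _ _ _ fun k => by simp [hj0]
  have := mul_nonneg (mul_nonneg (sub_nonneg.2 h1) (sub_nonneg.2 h2)) hR0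
  linarith

/-- Gordon's min-max comparison inequality for centred Gaussian measures. -/
theorem integral_ciInf_ciSup_le_of_covariance_le [Nonempty ι] [Nonempty κ]
    {μ ν : Measure (ι × κ → ℝ)} [IsGaussian μ] [IsGaussian ν] (hμ : μ[id] = 0) (hν : ν[id] = 0)
    (hle : ∀ i j, cov[fun x => x i, fun x => x j; ν] ≤ cov[fun x => x i, fun x => x j; μ])
    (heq : ∀ i j, i.1 = j.1 →
      cov[fun x => x i, fun x => x j; ν] = cov[fun x => x i, fun x => x j; μ])
    (c : ι → ℝ) :
    ∫ x, ⨅ u, ((⨆ k, x (u, k)) + c u) ∂ν ≤ ∫ x, ⨅ u, ((⨆ k, x (u, k)) + c u) ∂μ := by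
  set m : (ι × κ → ℝ) → ℝ := fun x => ⨅ u, ((⨆ k, x (u, k)) + c u) with hm
  have hlip : ∀ x y, |m x - m y| ≤ 1 * ‖x - y‖ := fun x y => by
    refine abs_ciInf_sub_ciInf_le (Set.finite_range _).bddBelow (Set.finite_range _).bddBelow
      fun u => ?_
    rw [add_sub_add_right_eq_sub]
    refine abs_ciSup_sub_ciSup_le (Set.finite_range _).bddAbove (Set.finite_range _).bddAbove
      fun k => ?_
    rw [one_mul]
    exact norm_le_pi_norm (x - y) (u, k)
  have hmm : Measurable m := (continuous_of_abs_sub_le hlip).measurable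
  have him : ∀ (ρ : Measure (ι × κ → ℝ)) [IsGaussian ρ], Integrable m ρ := fun ρ _ =>
    IsGaussian.integrable_of_abs_sub_le hlip
  -- The slack `η` is the width of the smoothing window; it is sent to zero at the end.
  have key : ∀ η : ℝ, 0 < η → ∫ x, (m x - η) ∂ν ≤ ∫ x, m x ∂μ := fun η hη => by
    refine integral_le_integral_of_forall_measure_lt_le hmm (hmm.sub_const η) (him μ)
      ((him ν).sub (integrable_const _)) fun t => ?_
    -- With this choice the smoothed step rises from 0 at level $t$ to 1 at level $t+\eta$, so
    -- `softMinMax` lies between the indicators of $m-\eta>t$ and $m>t$.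
    set b : ι → ℝ := fun u => (c u - t) / η with hb
    have hF := integral_le_integral_of_covariance_le hμ hν
      (continuous_softMinMax (κ := κ) (1 / η) b) (hasUniformTaylor_softMinMax (1 / η) b) hle
      fun i j hij w s hs => softMinMax_supermodular (by positivity) b
        (fun h => hij (heq i j h)) w hs
    have hab : ∀ (x : ι × κ → ℝ) u k, 1 / η * x (u, k) + b u = (x (u, k) + c u - t) / η :=
      fun x u k => by simp only [hb]; ring
    have hint : ∀ (ρ : Measure (ι × κ → ℝ)) [IsGaussian ρ],
        Integrable (softMinMax (1 / η) b) ρ := fun ρ _ =>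
      Integrable.of_bound (continuous_softMinMax _ _).aestronglyMeasurable 1 (.of_forall fun x => by
        rw [Real.norm_of_nonneg (softMinMax_nonneg _ _ _)]; exact softMinMax_le_one _ _ _)
    have h1 : ν.real {x | t < m x - η} ≤ ∫ x, softMinMax (1 / η) b x ∂ν := by
      rw [← integral_indicator_one (measurableSet_lt measurable_const (hmm.sub_const η))]
      refine integral_mono ((integrable_const 1).indicator
        (measurableSet_lt measurable_const (hmm.sub_const η))) (hint ν) fun x => ?_
      refine Set.indicator_le' (g := softMinMax (1 / η) b) (fun x hx => ?_)
        (fun x _ => softMinMax_nonneg _ _ _) x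
      refine (softMinMax_eq_one fun u => ?_).ge
      obtain ⟨k, hk⟩ := exists_eq_ciSup_of_finite (f := fun k => x (u, k))
      refine ⟨k, ?_⟩
      have h2 : m x ≤ (⨆ k, x (u, k)) + c u := ciInf_le (Set.finite_range _).bddBelow u
      rw [Set.mem_ofPred_eq] at hx
      rw [hab, one_le_div hη]
      linarith
    have h2 : ∫ x, softMinMax (1 / η) b x ∂μ ≤ μ.real {x | t < m x} := by
      rw [← integral_indicator_one (measurableSet_lt measurable_const hmm)]
      refine integral_mono (hint μ) ((integrable_const 1).indicator
        (measurableSet_lt measurable_const hmm)) fun x => ?_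
      refine Set.le_indicator (f := softMinMax (1 / η) b) (fun x _ => softMinMax_le_one _ _ _)
        (fun x hx => ?_) x
      refine (softMinMax_eq_zero ?_).le
      obtain ⟨u, hu⟩ := exists_eq_ciInf_of_finite (f := fun u => (⨆ k, x (u, k)) + c u)
      refine ⟨u, fun k => ?_⟩
      rw [hab]
      refine div_nonpos_of_nonpos_of_nonneg ?_ hη.le
      have h3 : x (u, k) ≤ ⨆ k, x (u, k) := le_ciSup (Set.finite_range fun k => x (u, k)).bddAbove k
      rw [Set.mem_ofPred_eq, not_lt] at hx
      have : m x = (⨆ k, x (u, k)) + c u := hu.symm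
      linarith
    exact (ENNReal.toReal_le_toReal (measure_ne_top _ _) (measure_ne_top _ _)).1
      (h1.trans (hF.trans h2))
  refine le_of_forall_pos_le_add fun η hη => ?_
  have := key η hη
  rw [integral_sub (him ν) (integrable_const _)] at this
  simp at this
  linarith

end Gordon

/-! ### Covariances and Gaussianity of product measures. -/

section Product

/-- By bilinearity the covariance is a double sum, whose off-diagonal terms vanish by independence
of the coordinates. -/
lemma covariance_sum_pi {ι : Type*} [Fintype ι] {Ω : ι → Type*} {mΩ : ∀ i, MeasurableSpace (Ω i)}
    {μ : (i : ι) → Measure (Ω i)} [∀ i, IsProbabilityMeasure (μ i)] {X Y : Π i, Ω i → ℝ}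
    (hX : ∀ i, MemLp (X i) 2 (μ i)) (hY : ∀ i, MemLp (Y i) 2 (μ i)) :
    cov[fun ω => ∑ i, X i (ω i), fun ω => ∑ i, Y i (ω i); Measure.pi μ]
      = ∑ i, cov[X i, Y i; μ i] := by
  have hX' : ∀ i, MemLp (fun ω : Π i, Ω i => X i (ω i)) 2 (Measure.pi μ) := fun i =>
    (hX i).comp_measurePreserving (measurePreserving_eval _ i)
  have hY' : ∀ i, MemLp (fun ω : Π i, Ω i => Y i (ω i)) 2 (Measure.pi μ) := fun i =>
    (hY i).comp_measurePreserving (measurePreserving_eval _ i)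
  rw [covariance_fun_sum_fun_sum hX' hY']
  refine Finset.sum_congr rfl fun i _ => ?_
  rw [Finset.sum_eq_single i]
  · have e := (measurePreserving_eval μ i).map_eq
    conv_rhs => rw [← e]
    rw [covariance_map (by rw [e]; exact (hX i).aestronglyMeasurable)
      (by rw [e]; exact (hY i).aestronglyMeasurable) (measurable_pi_apply i).aemeasurable]
    rfl
  · intro j _ hij
    refine IndepFun.covariance_eq_zero ?_ (hX' i) (hY' j)
    exact ((iIndepFun_pi (μ := μ) (X := fun _ => id) fun i => aemeasurable_id).indepFun
      hij.symm).comp₀ (φ := X i) (ψ := Y j) (measurable_pi_apply i).aemeasurable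
      (measurable_pi_apply j).aemeasurable
      (by
        have e := (measurePreserving_eval μ i).map_eq
        have h := (hX i).aestronglyMeasurable.aemeasurable
        rw [← e] at h
        exact h)
      (by
        have e := (measurePreserving_eval μ j).map_eq
        have h := (hY j).aestronglyMeasurable.aemeasurable
        rw [← e] at h
        exact h)
  · simp

lemma covariance_add_prod {α β : Type*} [MeasurableSpace α] [MeasurableSpace β] {μ : Measure α}
    {ν : Measure β} [IsProbabilityMeasure μ] [IsProbabilityMeasure ν] {X X' : α → ℝ}
    {Y Y' : β → ℝ} (hX : MemLp X 2 μ) (hX' : MemLp X' 2 μ) (hY : MemLp Y 2 ν)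
    (hY' : MemLp Y' 2 ν) :
    cov[fun p => X p.1 + Y p.2, fun p => X' p.1 + Y' p.2; μ.prod ν]
      = cov[X, X'; μ] + cov[Y, Y'; ν] := by
  have i1 := hX.comp_fst ν
  have i2 := hX'.comp_fst ν
  have i3 := hY.comp_snd μ
  have i4 := hY'.comp_snd μ
  have e := covariance_add_left i1 i3 (i2.add i4)
  rw [covariance_add_right i1 i2 i4, covariance_add_right i3 i2 i4] at e
  have c1 := covariance_fst_snd_prod hX hY'
  have c2 := covariance_fst_snd_prod hX' hY
  have c3 : cov[fun p : α × β => X p.1, fun p => X' p.1; μ.prod ν] = cov[X, X'; μ] := by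
    have h := measurePreserving_fst (μ := μ) (ν := ν)
    conv_rhs => rw [← h.map_eq]
    rw [covariance_map (by rw [h.map_eq]; exact hX.aestronglyMeasurable)
      (by rw [h.map_eq]; exact hX'.aestronglyMeasurable) (by fun_prop)]
    rfl
  have c4 : cov[fun p : α × β => Y p.2, fun p => Y' p.2; μ.prod ν] = cov[Y, Y'; ν] := by
    have h := measurePreserving_snd (μ := μ) (ν := ν)
    conv_rhs => rw [← h.map_eq]
    rw [covariance_map (by rw [h.map_eq]; exact hY.aestronglyMeasurable)
      (by rw [h.map_eq]; exact hY'.aestronglyMeasurable) (by fun_prop)]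
    rfl
  have c5 : cov[fun p : α × β => Y p.2, fun p => X' p.1; μ.prod ν] = 0 := by
    rw [covariance_comm]; exact c2
  have c6 : cov[fun p : α × β => X p.1, fun p => Y' p.2; μ.prod ν] = 0 := c1
  have e' : cov[fun p : α × β => X p.1 + Y p.2, fun p => X' p.1 + Y' p.2; μ.prod ν]
    = cov[fun p : α × β => X p.1, fun p => X' p.1; μ.prod ν]
      + cov[fun p : α × β => X p.1, fun p => Y' p.2; μ.prod ν]
      + (cov[fun p : α × β => Y p.2, fun p => X' p.1; μ.prod ν]
      + cov[fun p : α × β => Y p.2, fun p => Y' p.2; μ.prod ν]) := e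
  rw [e', c3, c4, c5, c6]
  ring

lemma integral_fst_add_snd {α β : Type*} [MeasurableSpace α] [MeasurableSpace β] {μ : Measure α}
    {ν : Measure β} [IsProbabilityMeasure μ] [IsProbabilityMeasure ν] {f : α → ℝ} {g : β → ℝ}
    (hf : Integrable f μ) (hg : Integrable g ν) :
    ∫ p, (f p.1 + g p.2) ∂(μ.prod ν) = ∫ x, f x ∂μ + ∫ y, g y ∂ν := by
  rw [integral_add (hf.comp_fst ν) (hg.comp_snd μ), integral_fun_fst, integral_fun_snd]
  simp

instance isGaussian_pi {ι : Type*} [Fintype ι] {E : ι → Type*} [∀ i, NormedAddCommGroup (E i)]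
    [∀ i, NormedSpace ℝ (E i)] [∀ i, MeasurableSpace (E i)] [∀ i, CompleteSpace (E i)]
    [∀ i, BorelSpace (E i)] [∀ i, SecondCountableTopology (E i)] (μ : ∀ i, Measure (E i))
    [∀ i, IsGaussian (μ i)] : IsGaussian (Measure.pi μ) := by
  have h : iIndepFun (fun i (x : ∀ i, E i) => x i) (Measure.pi μ) :=
    iIndepFun_pi (μ := μ) (X := fun _ => id) fun i => aemeasurable_id
  have := (h.hasGaussianLaw fun i => ⟨by
    rw [(measurePreserving_eval μ i).map_eq]; infer_instance⟩).isGaussian_map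
  simpa using this

lemma integral_id_pi_eq_zero {ι : Type*} [Fintype ι] {E : ι → Type*}
    [∀ i, NormedAddCommGroup (E i)]
    [∀ i, NormedSpace ℝ (E i)] [∀ i, MeasurableSpace (E i)] [∀ i, CompleteSpace (E i)]
    [∀ i, BorelSpace (E i)] [∀ i, SecondCountableTopology (E i)] (μ : ∀ i, Measure (E i))
    [∀ i, IsGaussian (μ i)] (h : ∀ i, (μ i)[id] = 0) : (Measure.pi μ)[id] = 0 := by
  ext i
  have hi : Integrable (id : (∀ i, E i) → _) (Measure.pi μ) := IsGaussian.integrable_id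
  rw [eval_integral (f := id) fun i => hi.eval i]
  have := integral_map (μ := Measure.pi μ) (φ := Function.eval i)
    (measurable_pi_apply i).aemeasurable (f := (id : E i → E i)) (by fun_prop)
  rw [(measurePreserving_eval μ i).map_eq, h i] at this
  exact this.symm

end Product

/-! ### Chevet's inequality on finite index sets. -/

section Chevet

lemma exists_abs_sub_le_of_finite {ι E : Type*} [Finite ι] [NormedAddCommGroup E]
    [NormedSpace ℝ E] (L : ι → E →L[ℝ] ℝ) :
    ∃ K : ℝ, ∀ i x y, |L i x - L i y| ≤ K * ‖x - y‖ := by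
  have := Fintype.ofFinite ι
  refine ⟨∑ i, ‖L i‖, fun i x y => ?_⟩
  rw [← map_sub]
  refine ((L i).le_opNorm _).trans ?_
  gcongr
  exact Finset.single_le_sum (f := fun i => ‖L i‖) (fun _ _ => norm_nonneg _) (Finset.mem_univ i)

lemma isGaussian_map_prod_centered {E E' F : Type*} [NormedAddCommGroup E] [NormedSpace ℝ E]
    [CompleteSpace E] [SecondCountableTopology E] [MeasurableSpace E] [BorelSpace E]
    [NormedAddCommGroup E'] [NormedSpace ℝ E'] [CompleteSpace E'] [SecondCountableTopology E']
    [MeasurableSpace E'] [BorelSpace E'] [NormedAddCommGroup F] [NormedSpace ℝ F]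
    [CompleteSpace F] [SecondCountableTopology F] [MeasurableSpace F] [BorelSpace F]
    {μ : Measure E} {ν : Measure E'} [IsGaussian μ] [IsGaussian ν] (hμ : μ[id] = 0)
    (hν : ν[id] = 0) (T : E × E' →L[ℝ] F) : ((μ.prod ν).map T)[id] = 0 := by
  have h0 : ∫ p : E × E', p ∂(μ.prod ν) = 0 := by
    have i1 : Integrable (fun p : E × E' => p.1) (μ.prod ν) :=
      (IsGaussian.integrable_id (μ := μ)).comp_fst ν
    have i2 : Integrable (fun p : E × E' => p.2) (μ.prod ν) :=
      (IsGaussian.integrable_id (μ := ν)).comp_snd μ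
    have e1 := integral_fun_fst (μ := μ) (ν := ν) (id : E → E)
    have e2 := integral_fun_snd (μ := μ) (ν := ν) (id : E' → E')
    rw [hμ] at e1
    rw [hν] at e2
    simp only [id_eq, smul_zero] at e1 e2
    rw [integral_pair i1 i2, e1, e2]
    rfl
  rw [integral_map (by fun_prop) (by fun_prop)]
  simp only [id_eq]
  rw [T.integral_comp_comm (φ := fun p : E × E' => p) IsGaussian.integrable_id, h0, map_zero]

variable {E : Type*} [NormedAddCommGroup E] [NormedSpace ℝ E] [CompleteSpace E]
  [SecondCountableTopology E] [MeasurableSpace E] [BorelSpace E]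

/-- Chevet's inequality for finite index sets, with deterministic shifts. -/
theorem chevet_finite {M : ℕ} {ι κ : Type*} [Fintype ι] [Fintype κ] [Nonempty ι] [Nonempty κ]
    (α : Measure E) [IsGaussian α] (hα : α[id] = 0) (ℓ : κ → E →L[ℝ] ℝ) {σ : ℝ}
    (hσ : ∀ k l, cov[ℓ k, ℓ l; α] ≤ σ ^ 2) (v : ι → EuclideanSpace ℝ (Fin M))
    (hv : ∀ u, ‖v u‖ = 1) (c : ι → ℝ) :
    ∫ x, ⨆ k, ℓ k x ∂α
      + ∫ g, ⨅ u, (σ * inner ℝ g (v u) + c u) ∂(stdGaussian (EuclideanSpace ℝ (Fin M)))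
      ≤ ∫ A, ⨅ u, ((⨆ k, ℓ k (∑ i, v u i • A i)) + c u) ∂(Measure.pi fun _ : Fin M => α) := by
  classical
  set L : ι × κ → (Fin M → E) →L[ℝ] ℝ := fun p =>
    (ℓ p.2).comp (∑ i, v p.1 i • ContinuousLinearMap.proj (R := ℝ) (φ := fun _ : Fin M => E) i)
    with hL
  have hLa : ∀ p A, L p A = ∑ i, v p.1 i * ℓ p.2 (A i) := fun p A => by simp [hL]
  -- The additional scalar Gaussian contributes $\sigma^2$ to every covariance, which makes the two
  -- processes agree within a row, where $\langle v,v\rangle=1$.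
  set T₁ : (Fin M → E) × ℝ →L[ℝ] (ι × κ → ℝ) := ContinuousLinearMap.pi fun p =>
    (L p).comp (ContinuousLinearMap.fst ℝ _ _) + σ • ContinuousLinearMap.snd ℝ _ _ with hT₁
  set T₂ : E × EuclideanSpace ℝ (Fin M) →L[ℝ] (ι × κ → ℝ) := ContinuousLinearMap.pi fun p =>
    (ℓ p.2).comp (ContinuousLinearMap.fst ℝ _ _)
      + (σ • innerSL ℝ (v p.1)).comp (ContinuousLinearMap.snd ℝ _ _) with hT₂
  have hT₁a : ∀ q p, T₁ q p = L p q.1 + σ * q.2 := fun q p => by simp [hT₁]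
  have hT₂a : ∀ q p, T₂ q p = ℓ p.2 q.1 + σ * inner ℝ (v p.1) q.2 := fun q p => by simp [hT₂]
  set π := Measure.pi fun _ : Fin M => α
  have hπ : π[id] = 0 := integral_id_pi_eq_zero _ fun _ => hα
  have hdual : ∀ (β : Measure E) [IsGaussian β] (f : E →L[ℝ] ℝ), MemLp f 2 β := fun β _ f =>
    IsGaussian.memLp_dual β f 2 (by norm_num)
  have hcovL : ∀ p q, cov[L p, L q; π] = inner ℝ (v p.1) (v q.1) * cov[ℓ p.2, ℓ q.2; α] := by
    intro p q
    have e : ∀ p, ⇑(L p) = fun A => ∑ i, v p.1 i * ℓ p.2 (A i) := fun p => funext (hLa p)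
    rw [e, e, covariance_sum_pi (X := fun i x => v p.1 i * ℓ p.2 x)
      (Y := fun i x => v q.1 i * ℓ q.2 x) (fun i => (hdual α _).const_mul _)
      (fun i => (hdual α _).const_mul _)]
    simp_rw [covariance_const_mul_left, covariance_const_mul_right, ← mul_assoc]
    rw [← Finset.sum_mul, PiLp.inner_apply]
    congr 1
    refine Finset.sum_congr rfl fun i _ => ?_
    simp [mul_comm]
  have hcov₁ : ∀ p q, cov[fun x => x p, fun x => x q; (π.prod (gaussianReal 0 1)).map T₁]
      = inner ℝ (v p.1) (v q.1) * cov[ℓ p.2, ℓ q.2; α] + σ ^ 2 := by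
    intro p q
    rw [covariance_map_fun (measurable_pi_apply p).aestronglyMeasurable
      (measurable_pi_apply q).aestronglyMeasurable (by fun_prop)]
    simp_rw [hT₁a]
    have hid : MemLp (fun t : ℝ => σ * t) 2 (gaussianReal 0 1) :=
      (IsGaussian.memLp_two_id (μ := gaussianReal 0 1)).const_mul σ
    rw [covariance_add_prod (IsGaussian.memLp_dual π (L p) 2 (by norm_num))
      (IsGaussian.memLp_dual π (L q) 2 (by norm_num)) hid hid, hcovL,
      covariance_const_mul_left, covariance_const_mul_right]
    have : cov[fun t : ℝ => t, fun t => t; gaussianReal 0 1] = 1 := by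
      rw [covariance_self (by fun_prop)]
      simp
    rw [this]
    ring
  have hcov₂ : ∀ p q, cov[fun x => x p, fun x => x q;
      (α.prod (stdGaussian (EuclideanSpace ℝ (Fin M)))).map T₂]
      = cov[ℓ p.2, ℓ q.2; α] + σ ^ 2 * inner ℝ (v p.1) (v q.1) := by
    intro p q
    rw [covariance_map_fun (measurable_pi_apply p).aestronglyMeasurable
      (measurable_pi_apply q).aestronglyMeasurable (by fun_prop)]
    simp_rw [hT₂a]
    have hin : ∀ w : EuclideanSpace ℝ (Fin M),
        MemLp (fun g : EuclideanSpace ℝ (Fin M) => inner ℝ w g) 2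
          (stdGaussian (EuclideanSpace ℝ (Fin M))) := fun w =>
      IsGaussian.memLp_dual (stdGaussian (EuclideanSpace ℝ (Fin M))) (innerSL ℝ w) 2 (by norm_num)
    rw [covariance_add_prod (hdual α _) (hdual α _) ((hin _).const_mul σ) ((hin _).const_mul σ),
      covariance_const_mul_left, covariance_const_mul_right]
    have h := covarianceBilin_apply_eq_cov (μ := stdGaussian (EuclideanSpace ℝ (Fin M)))
      IsGaussian.memLp_two_id
      (v p.1) (v q.1)
    rw [covarianceBilin_stdGaussian] at h
    rw [← h, innerSL_apply_apply]
    ring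
  have hvv : ∀ u u', inner ℝ (v u) (v u') ≤ 1 := fun u u' => by
    have := real_inner_le_norm (v u) (v u')
    rwa [hv, hv, one_mul] at this
  have G := integral_ciInf_ciSup_le_of_covariance_le
    (μ := (π.prod (gaussianReal 0 1)).map T₁)
    (ν := (α.prod (stdGaussian (EuclideanSpace ℝ (Fin M)))).map T₂)
    (isGaussian_map_prod_centered hπ (by simp) T₁)
    (isGaussian_map_prod_centered hα (by simp) T₂)
    (fun p q => by
      rw [hcov₁, hcov₂]
      have h1 := hvv p.1 q.1
      have h2 := hσ p.2 q.2
      -- The difference of the covariances is exactly the product of these two nonnegative factors.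
      nlinarith [mul_nonneg (sub_nonneg.2 h1) (sub_nonneg.2 h2)])
    (fun p q h => by
      rw [hcov₁, hcov₂, h, real_inner_self_eq_norm_sq, hv]; ring) c
  have hmc : Continuous fun x : ι × κ → ℝ => ⨅ u, ((⨆ k, x (u, k)) + c u) := by
    refine continuous_of_abs_sub_le (K := 1) fun x y => ?_
    refine abs_ciInf_sub_ciInf_le (Set.finite_range _).bddBelow (Set.finite_range _).bddBelow
      fun u => ?_
    rw [add_sub_add_right_eq_sub]
    refine abs_ciSup_sub_ciSup_le (Set.finite_range _).bddAbove (Set.finite_range _).bddAbove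
      fun k => ?_
    rw [one_mul]
    exact norm_le_pi_norm (x - y) (u, k)
  rw [integral_map (by fun_prop) hmc.aestronglyMeasurable,
    integral_map (by fun_prop) hmc.aestronglyMeasurable] at G
  have i1 : Integrable (fun x => ⨆ k, ℓ k x) α := by
    obtain ⟨K, hK⟩ := exists_abs_sub_le_of_finite ℓ
    exact IsGaussian.integrable_of_abs_sub_le (K := K) fun x y => abs_ciSup_sub_ciSup_le
      (Set.finite_range _).bddAbove (Set.finite_range _).bddAbove fun k => hK k x y
  have i2 : Integrable (fun g => ⨅ u, (σ * inner ℝ g (v u) + c u))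
      (stdGaussian (EuclideanSpace ℝ (Fin M))) := by
    obtain ⟨K, hK⟩ := exists_abs_sub_le_of_finite fun u => σ • innerSL ℝ (v u)
    refine IsGaussian.integrable_of_abs_sub_le (K := K) fun x y => abs_ciInf_sub_ciInf_le
      (Set.finite_range _).bddBelow (Set.finite_range _).bddBelow fun u => ?_
    rw [add_sub_add_right_eq_sub]
    simpa [real_inner_comm] using hK u x y
  have i3 : Integrable (fun A : Fin M → E => ⨅ u, ((⨆ k, ℓ k (∑ i, v u i • A i)) + c u)) π := by
    obtain ⟨K, hK⟩ := exists_abs_sub_le_of_finite L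
    refine IsGaussian.integrable_of_abs_sub_le (K := K) fun x y => abs_ciInf_sub_ciInf_le
      (Set.finite_range _).bddBelow (Set.finite_range _).bddBelow fun u => ?_
    rw [add_sub_add_right_eq_sub]
    refine abs_ciSup_sub_ciSup_le (Set.finite_range _).bddAbove (Set.finite_range _).bddAbove
      fun k => ?_
    simpa [hL] using hK (u, k) x y
  -- The scalar Gaussian does not depend on the indices, so it leaves the min-max and then
  -- integrates to zero.
  have e1 : ∀ q : (Fin M → E) × ℝ, ⨅ u, ((⨆ k, T₁ q (u, k)) + c u)
      = (⨅ u, ((⨆ k, ℓ k (∑ i, v u i • q.1 i)) + c u)) + σ * q.2 := fun q => by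
    rw [ciInf_add (Set.finite_range _).bddBelow]
    congr 1; ext u
    simp_rw [hT₁a]
    rw [← ciSup_add (Set.finite_range _).bddAbove]
    simp only [hL]
    simp
    ring
  have e2 : ∀ q : E × EuclideanSpace ℝ (Fin M), ⨅ u, ((⨆ k, T₂ q (u, k)) + c u)
      = (⨆ k, ℓ k q.1) + ⨅ u, (σ * inner ℝ q.2 (v u) + c u) := fun q => by
    rw [add_ciInf (Set.finite_range _).bddBelow]
    congr 1; ext u
    simp_rw [hT₂a]
    rw [← ciSup_add (Set.finite_range _).bddAbove, real_inner_comm]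
    ring
  simp_rw [e1, e2] at G
  have hid : Integrable (fun t : ℝ => σ * t) (gaussianReal 0 1) :=
    (IsGaussian.integrable_id (μ := gaussianReal 0 1)).const_mul σ
  rw [integral_fst_add_snd i3 hid, integral_fst_add_snd i1 i2, integral_const_mul] at G
  simpa using G

end Chevet

/-! ### Families with a common Lipschitz constant. -/

section LipschitzZero

/-- `f` vanishes at `0` and is Lipschitz with constant `K`. -/
def IsLipschitzZero {E : Type*} [NormedAddCommGroup E] (K : ℝ) (f : E → ℝ) : Prop :=
  f 0 = 0 ∧ ∀ x y, |f x - f y| ≤ K * ‖x - y‖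

namespace IsLipschitzZero

variable {E : Type*} [NormedAddCommGroup E] {ι : Sort*} {K : ℝ}

lemma abs_le {f : E → ℝ} (hf : IsLipschitzZero K f) (x : E) : |f x| ≤ K * ‖x‖ := by
  simpa [hf.1] using hf.2 x 0

lemma of_map_sub {f : E → ℝ} (hsub : ∀ x y, f (x - y) = f x - f y)
    (hK : ∀ x, |f x| ≤ K * ‖x‖) : IsLipschitzZero K f :=
  ⟨by simpa using hsub 0 0, fun x y => by rw [← hsub]; exact hK _⟩

/-- The shared constant `K` bounds the family at each point; without such bounds real suprema and
infima would take the default value 0. -/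
lemma bddAbove {f : ι → E → ℝ} (hf : ∀ i, IsLipschitzZero K (f i)) (x : E) :
    BddAbove (Set.range fun i => f i x) :=
  ⟨K * ‖x‖, by rintro _ ⟨i, rfl⟩; exact (le_abs_self _).trans ((hf i).abs_le x)⟩

lemma bddBelow {f : ι → E → ℝ} (hf : ∀ i, IsLipschitzZero K (f i)) (x : E) :
    BddBelow (Set.range fun i => f i x) :=
  ⟨-(K * ‖x‖), by rintro _ ⟨i, rfl⟩; exact (_root_.abs_le.1 ((hf i).abs_le x)).1⟩

variable [Nonempty ι]

lemma iSup {f : ι → E → ℝ} (hf : ∀ i, IsLipschitzZero K (f i)) :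
    IsLipschitzZero K fun x => ⨆ i, f i x :=
  ⟨by simp [fun i => (hf i).1], fun x y =>
    abs_ciSup_sub_ciSup_le (bddAbove hf x) (bddAbove hf y) fun i => (hf i).2 x y⟩

lemma iInf {f : ι → E → ℝ} (hf : ∀ i, IsLipschitzZero K (f i)) :
    IsLipschitzZero K fun x => ⨅ i, f i x :=
  ⟨by simp [fun i => (hf i).1], fun x y =>
    abs_ciInf_sub_ciInf_le (bddBelow hf x) (bddBelow hf y) fun i => (hf i).2 x y⟩

end IsLipschitzZero

end LipschitzZero

/-! ### The trace pairing and the Gaussian ensemble. -/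

section MatrixNorm

attribute [local instance] Matrix.normedAddCommGroup Matrix.normedSpace

/-- The topology of the entrywise supremum norm. -/
abbrev matrixNormTopology (m n : ℕ) : TopologicalSpace (Matrix (Fin m) (Fin n) ℝ) :=
  PseudoMetricSpace.toUniformSpace.toTopologicalSpace

attribute [local instance] matrixNormTopology

section Matrices

variable {m n : ℕ}

instance borelSpace_matrix : BorelSpace (Matrix (Fin m) (Fin n) ℝ) :=
  inferInstanceAs (BorelSpace (Fin m → Fin n → ℝ))

instance secondCountableTopology_matrix :
    SecondCountableTopology (Matrix (Fin m) (Fin n) ℝ) :=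
  inferInstanceAs (SecondCountableTopology (Fin m → Fin n → ℝ))

instance isGaussian_gaussianEnsemble : IsGaussian (gaussianEnsemble m n) :=
  inferInstanceAs (IsGaussian (Measure.pi fun _ : Fin m => Measure.pi fun _ : Fin n =>
    gaussianReal 0 1))

lemma integral_id_gaussianEnsemble : (gaussianEnsemble m n)[id] = 0 :=
  integral_id_pi_eq_zero (fun _ : Fin m => Measure.pi fun _ : Fin n => gaussianReal 0 1) fun _ =>
    integral_id_pi_eq_zero _ fun _ => by simp

lemma matInner_eq_sum (X Y : Matrix (Fin m) (Fin n) ℝ) :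
    matInner X Y = ∑ i, ∑ j, X i j * Y i j := by
  simp only [matInner, Matrix.trace, Matrix.diag_apply, Matrix.mul_apply, Matrix.transpose_apply]
  exact Finset.sum_comm

lemma matInner_comm (X Y : Matrix (Fin m) (Fin n) ℝ) : matInner X Y = matInner Y X := by
  simp only [matInner_eq_sum, mul_comm]

/-- The linear functional `X ↦ ⟨X, Z⟩`. -/
noncomputable def matInnerCLM (Z : Matrix (Fin m) (Fin n) ℝ) : Matrix (Fin m) (Fin n) ℝ →L[ℝ] ℝ :=
  LinearMap.toContinuousLinearMap
    { toFun := fun X => matInner X Z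
      map_add' := fun X Y => by simp [matInner, Matrix.add_mul]
      map_smul' := fun c X => by simp [matInner] }

lemma matInner_sub_left (X Y Z : Matrix (Fin m) (Fin n) ℝ) :
    matInner (X - Y) Z = matInner X Z - matInner Y Z := map_sub (matInnerCLM Z) X Y

lemma matInner_smul_left (c : ℝ) (X Z : Matrix (Fin m) (Fin n) ℝ) :
    matInner (c • X) Z = c * matInner X Z := map_smul (matInnerCLM Z) c X

lemma matInner_neg_left (X Z : Matrix (Fin m) (Fin n) ℝ) :
    matInner (-X) Z = -matInner X Z := map_neg (matInnerCLM Z) X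

lemma matInner_zero_left (Z : Matrix (Fin m) (Fin n) ℝ) :
    matInner 0 Z = 0 := map_zero (matInnerCLM Z)

lemma matInner_sub_right (X Y Z : Matrix (Fin m) (Fin n) ℝ) :
    matInner X (Y - Z) = matInner X Y - matInner X Z := by
  rw [matInner_comm, matInner_sub_left, matInner_comm Y, matInner_comm Z]

/-- Here the norm is the entrywise supremum. The crude constant suffices, since it enters only
Lipschitz bounds and errors proportional to the mesh. -/
lemma abs_matInner_le (X Y : Matrix (Fin m) (Fin n) ℝ) :
    |matInner X Y| ≤ (m * n) * ‖X‖ * ‖Y‖ := by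
  rw [matInner_eq_sum]
  calc |∑ i, ∑ j, X i j * Y i j| ≤ ∑ i : Fin m, ∑ j : Fin n, ‖X‖ * ‖Y‖ := by
        refine (Finset.abs_sum_le_sum_abs _ _).trans (Finset.sum_le_sum fun i _ => ?_)
        refine (Finset.abs_sum_le_sum_abs _ _).trans (Finset.sum_le_sum fun j _ => ?_)
        rw [abs_mul]
        exact mul_le_mul (Matrix.norm_entry_le_entrywise_sup_norm X)
          (Matrix.norm_entry_le_entrywise_sup_norm Y) (abs_nonneg _) (norm_nonneg _)
    _ = _ := by simp; ring

lemma matInner_self_nonneg (X : Matrix (Fin m) (Fin n) ℝ) : 0 ≤ matInner X X := by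
  rw [matInner_eq_sum]
  exact Finset.sum_nonneg fun i _ => Finset.sum_nonneg fun j _ => mul_self_nonneg _

lemma frobNorm_sq (X : Matrix (Fin m) (Fin n) ℝ) : frobNorm X ^ 2 = matInner X X :=
  Real.sq_sqrt (matInner_self_nonneg X)

lemma matInner_le_frobNorm_mul (X Y : Matrix (Fin m) (Fin n) ℝ) :
    matInner X Y ≤ frobNorm X * frobNorm Y := by
  simp only [frobNorm, matInner_eq_sum, ← Fintype.sum_prod_type', ← pow_two]
  exact Real.sum_mul_le_sqrt_mul_sqrt _ _ _

lemma norm_le_frobNorm (X : Matrix (Fin m) (Fin n) ℝ) : ‖X‖ ≤ frobNorm X := by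
  refine (Matrix.norm_le_iff (Real.sqrt_nonneg _)).2 fun i j => ?_
  refine Real.abs_le_sqrt ?_
  rw [matInner_eq_sum, pow_two]
  refine (Finset.single_le_sum (f := fun j => X i j * X i j) (fun _ _ => mul_self_nonneg _)
    (Finset.mem_univ j)).trans ?_
  exact Finset.single_le_sum (f := fun i => ∑ j, X i j * X i j)
    (fun _ _ => Finset.sum_nonneg fun _ _ => mul_self_nonneg _) (Finset.mem_univ i)

lemma covariance_matInner_gaussianEnsemble (Z Z' : Matrix (Fin m) (Fin n) ℝ) :
    cov[matInnerCLM Z, matInnerCLM Z'; gaussianEnsemble m n] = matInner Z Z' := by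
  have e : ∀ Z : Matrix (Fin m) (Fin n) ℝ, ⇑(matInnerCLM Z)
      = fun X : Fin m → Fin n → ℝ => ∑ i, ∑ j, X i j * Z i j := fun Z =>
    funext fun X => matInner_eq_sum X Z
  have hid : ∀ c : ℝ, MemLp (fun t : ℝ => t * c) 2 (gaussianReal 0 1) := fun c =>
    (IsGaussian.memLp_two_id (μ := gaussianReal 0 1)).mul_const c
  have hrow : ∀ (Z : Matrix (Fin m) (Fin n) ℝ) i, MemLp (fun x : Fin n → ℝ => ∑ j, x j * Z i j) 2
      (Measure.pi fun _ : Fin n => gaussianReal 0 1) := fun Z i =>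
    memLp_finsetSum _ fun j _ => (hid (Z i j)).comp_measurePreserving (measurePreserving_eval _ j)
  rw [e, e, gaussianEnsemble, matInner_eq_sum]
  refine (covariance_sum_pi (X := fun i (x : Fin n → ℝ) => ∑ j, x j * Z i j)
    (Y := fun i (x : Fin n → ℝ) => ∑ j, x j * Z' i j) (hrow Z) (hrow Z')).trans ?_
  refine Finset.sum_congr rfl fun i _ => ?_
  refine (covariance_sum_pi (X := fun j t => t * Z i j) (Y := fun j t => t * Z' i j)
    (fun j => hid _) (fun j => hid _)).trans ?_
  refine Finset.sum_congr rfl fun j _ => ?_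
  rw [covariance_mul_const_left, covariance_mul_const_right]
  have : cov[fun t : ℝ => t, fun t => t; gaussianReal 0 1] = 1 := by
    rw [covariance_self (by fun_prop)]
    simp
  rw [this, one_mul, mul_comm]

end Matrices

/-! ### Seminorms in finite dimension and Hahn–Banach. -/

section Seminorms

variable {E : Type*} [NormedAddCommGroup E] [NormedSpace ℝ E] [FiniteDimensional ℝ E]

lemma Seminorm.continuous_of_finiteDimensional (p : Seminorm ℝ E) : Continuous p :=
  continuousOn_univ.1 (p.convexOn.continuousOn isOpen_univ)

lemma Seminorm.exists_le_mul_norm (p : Seminorm ℝ E) : ∃ C, 0 ≤ C ∧ ∀ x, p x ≤ C * ‖x‖ := by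
  obtain ⟨C, hC, h⟩ := Seminorm.bound_of_continuous_normedSpace p p.continuous_of_finiteDimensional
  exact ⟨C, hC.le, h⟩

/-- The definite seminorm `p` is continuous, so it has a positive minimum on the compact unit
sphere; that sphere is empty in dimension zero. -/
lemma Seminorm.exists_norm_le_mul (p : Seminorm ℝ E) (hp : ∀ x, p x = 0 → x = 0) :
    ∃ C, 0 ≤ C ∧ ∀ x, ‖x‖ ≤ C * p x := by
  have hsph : ∀ x : E, x ≠ 0 → ‖x‖⁻¹ • x ∈ Metric.sphere (0 : E) 1 := fun x hx => by
    simp [norm_smul, hx]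
  rcases (Metric.sphere (0 : E) 1).eq_empty_or_nonempty with h | h
  · refine ⟨0, le_rfl, fun x => ?_⟩
    by_cases hx : x = 0
    · simp [hx]
    · have := hsph x hx
      rw [h] at this
      exact this.elim
  · obtain ⟨y, hy, hmin⟩ := (isCompact_sphere (0 : E) 1).exists_isMinOn h
      p.continuous_of_finiteDimensional.continuousOn
    have hy0 : y ≠ 0 := by rintro rfl; simp at hy
    have hpy : 0 < p y := (apply_nonneg p y).lt_of_ne fun h => hy0 (hp y h.symm)
    refine ⟨(p y)⁻¹, by positivity, fun x => ?_⟩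
    by_cases hx : x = 0
    · simp [hx]
    · have h1 : p y ≤ p (‖x‖⁻¹ • x) := hmin (hsph x hx)
      have hx0 : 0 < ‖x‖ := norm_pos_iff.2 hx
      rw [map_smul_eq_mul, norm_inv, norm_norm, ← div_eq_inv_mul, le_div_iff₀ hx0] at h1
      rw [← div_eq_inv_mul, le_div_iff₀ hpy]
      linarith

/-- Hahn–Banach: on the line through `x` the functional $cx\mapsto c\,p(x)$ is dominated by
$|c|\,p(x)$, and it extends under the sublinear bound `p`. -/
lemma Seminorm.exists_linear_eq_of_le {F : Type*} [AddCommGroup F] [Module ℝ F]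
    (p : Seminorm ℝ F) (x : F) : ∃ g : F →ₗ[ℝ] ℝ, g x = p x ∧ ∀ y, g y ≤ p y := by
  by_cases hx : x = 0
  · exact ⟨0, by simp [hx], fun y => by simp⟩
  obtain ⟨g, hg, hle⟩ := exists_extension_of_le_sublinear
    (LinearPMap.mkSpanSingleton x (p x) hx) p
    (fun c hc y => by rw [map_smul_eq_mul, Real.norm_of_nonneg hc.le]) (map_add_le_add p)
    (fun y => by
      obtain ⟨y, hy⟩ := y
      obtain ⟨c, rfl⟩ := Submodule.mem_span_singleton.1 hy
      refine (LinearPMap.mkSpanSingleton'_apply _ _ _ c _).trans_le ?_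
      rw [smul_eq_mul, map_smul_eq_mul, RingHom.id_apply]
      gcongr
      exact le_abs_self c)
  refine ⟨g, ?_, hle⟩
  exact (hg ⟨x, Submodule.mem_span_singleton_self x⟩).trans
    (LinearPMap.mkSpanSingleton_apply ℝ ℝ hx (p x))

lemma Seminorm.exists_eq_one {F : Type*} [AddCommGroup F] [Module ℝ F]
    {p : Seminorm ℝ F} {x : F} (hx : p x ≠ 0) : p ((p x)⁻¹ • x) = 1 := by
  rw [map_smul_eq_mul, norm_inv, Real.norm_of_nonneg (apply_nonneg p x), inv_mul_cancel₀ hx]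

end Seminorms

/-! ### The dual norm and its sphere. -/

section Duality

variable {m n : ℕ} {p : Seminorm ℝ (Matrix (Fin m) (Fin n) ℝ)}

lemma exists_matInner_eq (g : Matrix (Fin m) (Fin n) ℝ →ₗ[ℝ] ℝ) :
    ∃ Z, ∀ X, g X = matInner X Z := by
  refine ⟨Matrix.of fun i j => g (Matrix.single i j 1), fun X => ?_⟩
  conv_lhs => rw [Matrix.matrix_eq_sum_single X]
  rw [matInner_eq_sum, map_sum]
  refine Finset.sum_congr rfl fun i _ => ?_
  rw [map_sum]
  refine Finset.sum_congr rfl fun j _ => ?_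
  have : Matrix.single i j (X i j) = X i j • Matrix.single i j (1 : ℝ) := by
    simp [Matrix.smul_single]
  rw [this, map_smul, smul_eq_mul, Matrix.of_apply]

lemma bddAbove_matInner (hp : ∀ X, p X = 0 → X = 0) (Z : Matrix (Fin m) (Fin n) ℝ) :
    BddAbove (Set.range fun Y : {Y : Matrix (Fin m) (Fin n) ℝ // p Y = 1} => matInner Y.1 Z) := by
  obtain ⟨C, hC, h⟩ := p.exists_norm_le_mul hp
  refine ⟨m * n * C * ‖Z‖, ?_⟩
  rintro _ ⟨Y, rfl⟩
  refine (le_abs_self _).trans ((abs_matInner_le _ _).trans ?_)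
  have := h Y.1
  rw [Y.2, mul_one] at this
  gcongr

lemma matInner_le_of_dualNorm_eq_one (hp : ∀ X, p X = 0 → X = 0) {Z : Matrix (Fin m) (Fin n) ℝ}
    (hZ : dualNorm p Z = 1) (X : Matrix (Fin m) (Fin n) ℝ) : matInner X Z ≤ p X := by
  by_cases hX : p X = 0
  · rw [hp X hX, matInner_zero_left]; simp
  have h : matInner ((p X)⁻¹ • X) Z ≤ dualNorm p Z :=
    le_ciSup (bddAbove_matInner hp Z) ⟨_, Seminorm.exists_eq_one hX⟩
  rw [hZ, matInner_smul_left, ← div_eq_inv_mul,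
    div_le_one ((apply_nonneg p X).lt_of_ne (Ne.symm hX))] at h
  exact h

/-- `Z` represents the Hahn–Banach functional supporting `p` at `X`. Domination by `p` gives dual
norm at most one, and the normalised `X` attains it. -/
lemma exists_dualNorm_eq_one (hp : ∀ X, p X = 0 → X = 0) {X : Matrix (Fin m) (Fin n) ℝ}
    (hX : X ≠ 0) : ∃ Z, dualNorm p Z = 1 ∧ matInner X Z = p X := by
  obtain ⟨g, hgX, hg⟩ := p.exists_linear_eq_of_le X
  obtain ⟨Z, hZ⟩ := exists_matInner_eq g
  have hpX : p X ≠ 0 := fun h => hX (hp X h)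
  refine ⟨Z, ?_, by rw [← hZ, hgX]⟩
  have : Nonempty {Y : Matrix (Fin m) (Fin n) ℝ // p Y = 1} := ⟨⟨_, Seminorm.exists_eq_one hpX⟩⟩
  refine le_antisymm (ciSup_le fun Y => ?_) ?_
  · rw [← hZ]; exact (hg _).trans_eq Y.2
  · have h : matInner ((p X)⁻¹ • X) Z ≤ dualNorm p Z :=
      le_ciSup (bddAbove_matInner hp Z) ⟨_, Seminorm.exists_eq_one hpX⟩
    rwa [matInner_smul_left, ← hZ, hgX, inv_mul_cancel₀ hpX] at h

/-- Pairing `Z` with itself gives $\|Z\|_F^2\le p(Z)\le C\|Z\|_F$. This makes the supremum in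
`normSigma` a genuine one. -/
lemma exists_frobNorm_le_of_dualNorm_eq_one (hp : ∀ X, p X = 0 → X = 0) :
    ∃ R, 0 ≤ R ∧ ∀ Z, dualNorm p Z = 1 → frobNorm Z ≤ R := by
  obtain ⟨C, hC, h⟩ := p.exists_le_mul_norm
  refine ⟨C, hC, fun Z hZ => ?_⟩
  have h1 := matInner_le_of_dualNorm_eq_one hp hZ Z
  rw [← frobNorm_sq] at h1
  have h2 : C * ‖Z‖ ≤ C * frobNorm Z := by gcongr; exact norm_le_frobNorm Z
  have h3 : frobNorm Z ^ 2 ≤ C * frobNorm Z := (h1.trans (h Z)).trans h2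
  have h4 : 0 ≤ frobNorm Z := Real.sqrt_nonneg _
  rcases h4.eq_or_lt with h0 | h0
  · rw [← h0]; exact hC
  · exact le_of_mul_le_mul_right (by linarith [pow_two (frobNorm Z)]) h0

lemma frobNorm_le_normSigma (hp : ∀ X, p X = 0 → X = 0) {Z : Matrix (Fin m) (Fin n) ℝ}
    (hZ : dualNorm p Z = 1) : frobNorm Z ≤ normSigma p := by
  obtain ⟨R, -, hR⟩ := exists_frobNorm_le_of_dualNorm_eq_one hp
  exact le_ciSup (f := fun Z : {Z : Matrix (Fin m) (Fin n) ℝ // dualNorm p Z = 1} => frobNorm Z.1)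
    ⟨R, by rintro _ ⟨Z, rfl⟩; exact hR Z.1 Z.2⟩ ⟨Z, hZ⟩

lemma matInner_le_normSigma_sq (hp : ∀ X, p X = 0 → X = 0) {Z Z' : Matrix (Fin m) (Fin n) ℝ}
    (hZ : dualNorm p Z = 1) (hZ' : dualNorm p Z' = 1) : matInner Z Z' ≤ normSigma p ^ 2 := by
  refine (matInner_le_frobNorm_mul Z Z').trans ?_
  rw [pow_two]
  exact mul_le_mul (frobNorm_le_normSigma hp hZ) (frobNorm_le_normSigma hp hZ')
    (Real.sqrt_nonneg _) ((Real.sqrt_nonneg _).trans (frobNorm_le_normSigma hp hZ))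

variable [NeZero m] [NeZero n]

lemma exists_matrix_ne_zero : ∃ X : Matrix (Fin m) (Fin n) ℝ, X ≠ 0 :=
  ⟨Matrix.single 0 0 1, fun h => by simpa using congrFun₂ h 0 0⟩

lemma nonempty_seminorm_eq_one (hp : ∀ X, p X = 0 → X = 0) :
    Nonempty {Y : Matrix (Fin m) (Fin n) ℝ // p Y = 1} := by
  obtain ⟨X, hX⟩ := exists_matrix_ne_zero (m := m) (n := n)
  exact ⟨⟨_, Seminorm.exists_eq_one fun h => hX (hp X h)⟩⟩

lemma nonempty_dualNorm_eq_one (hp : ∀ X, p X = 0 → X = 0) :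
    Nonempty {Z : Matrix (Fin m) (Fin n) ℝ // dualNorm p Z = 1} := by
  obtain ⟨X, hX⟩ := exists_matrix_ne_zero (m := m) (n := n)
  obtain ⟨Z, hZ, -⟩ := exists_dualNorm_eq_one hp hX
  exact ⟨⟨Z, hZ⟩⟩

lemma exists_le_matInner (hp : ∀ X, p X = 0 → X = 0) (X : Matrix (Fin m) (Fin n) ℝ) :
    ∃ Z, dualNorm p Z = 1 ∧ p X = matInner X Z := by
  by_cases hX : X = 0
  · obtain ⟨Z, hZ⟩ := nonempty_dualNorm_eq_one hp
    exact ⟨Z, hZ, by simp [hX, matInner_zero_left]⟩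
  · obtain ⟨Z, hZ, h⟩ := exists_dualNorm_eq_one hp hX
    exact ⟨Z, hZ, h.symm⟩

end Duality

/-! ### Linear combinations and approximation of the min-max by nets. -/

section Combinations

variable {M m n : ℕ}

lemma matComb_sub_right (v : EuclideanSpace ℝ (Fin M)) (A B : Fin M → Matrix (Fin m) (Fin n) ℝ) :
    matComb v (A - B) = matComb v A - matComb v B := by
  simp [matComb, smul_sub, Finset.sum_sub_distrib]

lemma matComb_sub_left (v w : EuclideanSpace ℝ (Fin M)) (A : Fin M → Matrix (Fin m) (Fin n) ℝ) :
    matComb (v - w) A = matComb v A - matComb w A := by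
  simp [matComb, sub_smul, Finset.sum_sub_distrib]

lemma matComb_neg_right (v : EuclideanSpace ℝ (Fin M)) (A : Fin M → Matrix (Fin m) (Fin n) ℝ) :
    matComb v (-A) = -matComb v A := by
  simp [matComb]

lemma norm_matComb_le (v : EuclideanSpace ℝ (Fin M)) (A : Fin M → Matrix (Fin m) (Fin n) ℝ) :
    ‖matComb v A‖ ≤ M * ‖v‖ * ‖A‖ := by
  calc ‖matComb v A‖ ≤ ∑ _i : Fin M, ‖v‖ * ‖A‖ := by
        refine norm_sum_le_of_le _ fun i _ => ?_
        rw [norm_smul]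
        exact mul_le_mul (PiLp.norm_apply_le v i) (norm_le_pi_norm A i) (norm_nonneg _)
          (norm_nonneg _)
    _ = _ := by simp; ring

lemma abs_matInner_matComb_le (v : EuclideanSpace ℝ (Fin M))
    (A : Fin M → Matrix (Fin m) (Fin n) ℝ) (Z : Matrix (Fin m) (Fin n) ℝ) :
    |matInner (matComb v A) Z| ≤ m * n * (M * ‖v‖ * ‖A‖) * ‖Z‖ :=
  (abs_matInner_le _ _).trans (by gcongr; exact norm_matComb_le v A)

end Combinations

section MinMax

variable {M D₁ D₂ : ℕ} {p : Seminorm ℝ (Matrix (Fin D₁) (Fin D₁) ℝ)}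
  {b : Seminorm ℝ (Matrix (Fin D₂) (Fin D₂) ℝ)}

lemma exists_norm_le_of_dualNorm_eq_one (hp : ∀ X, p X = 0 → X = 0) :
    ∃ R, 0 ≤ R ∧ ∀ Z, dualNorm p Z = 1 → ‖Z‖ ≤ R := by
  obtain ⟨R, hR0, hR⟩ := exists_frobNorm_le_of_dualNorm_eq_one hp
  exact ⟨R, hR0, fun Z hZ => (norm_le_frobNorm Z).trans (hR Z hZ)⟩

lemma exists_norm_le_of_eq_one (hb : ∀ Y, b Y = 0 → Y = 0) :
    ∃ R, 0 ≤ R ∧ ∀ Y, b Y = 1 → ‖Y‖ ≤ R := by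
  obtain ⟨R, hR0, hR⟩ := b.exists_norm_le_mul hb
  exact ⟨R, hR0, fun Y hY => (hR Y).trans (by rw [hY, mul_one])⟩

lemma exists_isLipschitzZero_inner (hp : ∀ X, p X = 0 → X = 0) (hb : ∀ Y, b Y = 0 → Y = 0) :
    ∃ K : ℝ, ∀ (v : {v : EuclideanSpace ℝ (Fin M) // ‖v‖ = 1})
      (Y : {Y : Matrix (Fin D₂) (Fin D₂) ℝ // b Y = 1})
      (Z : {Z : Matrix (Fin D₁) (Fin D₁) ℝ // dualNorm p Z = 1}),
      IsLipschitzZero K fun x : (Fin M → Matrix (Fin D₁) (Fin D₁) ℝ) ×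
        (Fin M → Matrix (Fin D₂) (Fin D₂) ℝ) =>
        matInner (matComb v.1 x.1) Z.1 + matInner (matComb v.1 x.2) Y.1 := by
  obtain ⟨R, hR0, hR⟩ := exists_norm_le_of_dualNorm_eq_one hp
  obtain ⟨S, hS0, hS⟩ := exists_norm_le_of_eq_one hb
  refine ⟨D₁ * D₁ * M * R + D₂ * D₂ * M * S, fun v Y Z => .of_map_sub (fun x y => ?_) fun x => ?_⟩
  · simp only [Prod.fst_sub, Prod.snd_sub, matComb_sub_right, matInner_sub_left]
    ring
  · refine (abs_add_le _ _).trans ?_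
    have h1 := abs_matInner_matComb_le v.1 x.1 Z.1
    have h2 := abs_matInner_matComb_le v.1 x.2 Y.1
    rw [v.2, mul_one] at h1 h2
    rw [add_mul]
    refine add_le_add (h1.trans ?_) (h2.trans ?_)
    · calc _ ≤ D₁ * D₁ * (M * ‖x‖) * R := by
            gcongr
            · exact norm_fst_le x
            · exact hR _ Z.2
        _ = _ := by ring
    · calc _ ≤ D₂ * D₂ * (M * ‖x‖) * S := by
            gcongr
            · exact norm_snd_le x
            · exact hS _ Y.2
        _ = _ := by ring

lemma exists_isLipschitzZero_supSup_inner (s : ℝ) (hb : ∀ Y, b Y = 0 → Y = 0) :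
    ∃ K : ℝ, ∀ (v : {v : EuclideanSpace ℝ (Fin M) // ‖v‖ = 1})
      (Y : {Y : Matrix (Fin D₂) (Fin D₂) ℝ // b Y = 1}),
      IsLipschitzZero K fun x : EuclideanSpace ℝ (Fin M) ×
        (Fin M → Matrix (Fin D₂) (Fin D₂) ℝ) =>
        s * inner ℝ x.1 v.1 + matInner (matComb v.1 x.2) Y.1 := by
  obtain ⟨S, hS0, hS⟩ := exists_norm_le_of_eq_one hb
  refine ⟨|s| + D₂ * D₂ * M * S, fun v Y => .of_map_sub (fun x y => ?_) fun x => ?_⟩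
  · simp only [Prod.fst_sub, Prod.snd_sub, matComb_sub_right, matInner_sub_left, inner_sub_left]
    ring
  · refine (abs_add_le _ _).trans ?_
    have h1 := abs_real_inner_le_norm x.1 v.1
    have h2 := abs_matInner_matComb_le v.1 x.2 Y.1
    rw [v.2, mul_one] at h1 h2
    rw [add_mul, abs_mul]
    refine add_le_add ?_ (h2.trans ?_)
    · gcongr
      exact h1.trans (norm_fst_le x)
    · calc _ ≤ D₂ * D₂ * (M * ‖x‖) * S := by
            gcongr
            · exact norm_snd_le x
            · exact hS _ Y.2
        _ = _ := by ring

/-- Changing the sign of the data turns minus a supremum into a lower bound for every value, hence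
for an infimum over a net. -/
lemma neg_supSupFun_neg_le [NeZero D₂] (s : ℝ) (hb : ∀ Y, b Y = 0 → Y = 0)
    (g : EuclideanSpace ℝ (Fin M))
    (B : Fin M → Matrix (Fin D₂) (Fin D₂) ℝ) {v : EuclideanSpace ℝ (Fin M)} (hv : ‖v‖ = 1)
    {Y : Matrix (Fin D₂) (Fin D₂) ℝ} (hY : b Y = 1) :
    -supSupFun s b (-g) (-B) ≤ s * inner ℝ g v + matInner (matComb v B) Y := by
  obtain ⟨K, hK⟩ := exists_isLipschitzZero_supSup_inner (M := M) s hb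
  have := nonempty_seminorm_eq_one hb
  have h1 := le_ciSup (IsLipschitzZero.bddAbove (fun Y => hK ⟨v, hv⟩ Y) (-g, -B)) ⟨Y, hY⟩
  have h2 := le_ciSup (IsLipschitzZero.bddAbove
    (fun v => IsLipschitzZero.iSup fun Y => hK v Y) (-g, -B)) ⟨v, hv⟩
  have h3 : s * inner ℝ (-g) v + matInner (matComb v (-B)) Y ≤ supSupFun s b (-g) (-B) :=
    h1.trans h2
  rw [inner_neg_left, matComb_neg_right, matInner_neg_left] at h3
  linarith

variable [NeZero M] [NeZero D₁] [NeZero D₂]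

lemma nonempty_norm_eq_one : Nonempty {v : EuclideanSpace ℝ (Fin M) // ‖v‖ = 1} :=
  ⟨⟨EuclideanSpace.single 0 1, by simp⟩⟩

lemma exists_isLipschitzZero_infSupFun (hp : ∀ X, p X = 0 → X = 0) (hb : ∀ Y, b Y = 0 → Y = 0) :
    ∃ K : ℝ, IsLipschitzZero K fun x : (Fin M → Matrix (Fin D₁) (Fin D₁) ℝ) ×
        (Fin M → Matrix (Fin D₂) (Fin D₂) ℝ) => infSupFun p b x.1 x.2 := by
  obtain ⟨K, hK⟩ := exists_isLipschitzZero_inner (M := M) hp hb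
  have := nonempty_norm_eq_one (M := M)
  have := nonempty_seminorm_eq_one hb
  have := nonempty_dualNorm_eq_one hp
  exact ⟨K, .iInf fun v => .iInf fun Y => .iSup fun Z => hK v Y Z⟩

lemma exists_isLipschitzZero_supSupFun (s : ℝ) (hb : ∀ Y, b Y = 0 → Y = 0) :
    ∃ K : ℝ, IsLipschitzZero K fun x : EuclideanSpace ℝ (Fin M) ×
        (Fin M → Matrix (Fin D₂) (Fin D₂) ℝ) => supSupFun s b x.1 x.2 := by
  obtain ⟨K, hK⟩ := exists_isLipschitzZero_supSup_inner (M := M) s hb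
  have := nonempty_norm_eq_one (M := M)
  have := nonempty_seminorm_eq_one hb
  exact ⟨K, .iSup fun v => .iSup fun Y => hK v Y⟩

/-- If the points `(v, Y)` have `δ`-approximations in the finite family `u`, then the min-max over
the family and finitely many `z` is at most `infSupFun` up to an error of order `δ`. -/
lemma exists_ciInf_le_infSupFun_add (hp : ∀ X, p X = 0 → X = 0) (hb : ∀ Y, b Y = 0 → Y = 0)
    (B : Fin M → Matrix (Fin D₂) (Fin D₂) ℝ) :
    ∃ C C' : ℝ, 0 ≤ C ∧ 0 ≤ C' ∧ ∀ (δ : ℝ), 0 < δ →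
      ∀ {ι κ : Type} [Finite ι] [Finite κ] [Nonempty κ]
      (u : ι → EuclideanSpace ℝ (Fin M) × Matrix (Fin D₂) (Fin D₂) ℝ)
      (_ : ∀ i, ‖(u i).1‖ = 1)
      (_ : ∀ x : EuclideanSpace ℝ (Fin M) × Matrix (Fin D₂) (Fin D₂) ℝ, ‖x.1‖ = 1 → b x.2 = 1 →
        ∃ i, ‖x - u i‖ ≤ δ)
      (z : κ → Matrix (Fin D₁) (Fin D₁) ℝ) (_ : ∀ k, dualNorm p (z k) = 1)
      (A : Fin M → Matrix (Fin D₁) (Fin D₁) ℝ),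
      ⨅ i, ((⨆ k, matInner (matComb (u i).1 A) (z k)) + matInner (matComb (u i).1 B) (u i).2)
        ≤ infSupFun p b A B + δ * (C * ‖A‖ + C') := by
  obtain ⟨R, hR0, hR⟩ := exists_norm_le_of_dualNorm_eq_one hp
  obtain ⟨S, hS0, hS⟩ := exists_norm_le_of_eq_one hb
  obtain ⟨K, hK⟩ := exists_isLipschitzZero_inner (M := M) hp hb
  have := nonempty_norm_eq_one (M := M)
  have := nonempty_seminorm_eq_one hb
  have := nonempty_dualNorm_eq_one hp
  refine ⟨D₁ * D₁ * M * R, D₂ * D₂ * (M * ‖B‖) + D₂ * D₂ * (M * ‖B‖) * S, by positivity,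
    by positivity, fun δ hδ ι κ _ _ _ u hu1 hu z hz A => ?_⟩
  rw [← sub_le_iff_le_add]
  refine le_ciInf fun v => le_ciInf fun Y => ?_
  obtain ⟨i, hi⟩ := hu (v.1, Y.1) v.2 Y.2
  have d1 : ‖(u i).1 - v.1‖ ≤ δ := by
    rw [norm_sub_rev]; exact (norm_fst_le _).trans hi
  have d2 : ‖(u i).2 - Y.1‖ ≤ δ := by
    rw [norm_sub_rev]; exact (norm_snd_le _).trans hi
  rw [sub_le_iff_le_add]
  refine (ciInf_le (Set.finite_range _).bddBelow i).trans ?_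
  obtain ⟨k, hk⟩ := exists_eq_ciSup_of_finite (f := fun k => matInner (matComb (u i).1 A) (z k))
  rw [← hk]
  -- The points `z k` lie on the dual sphere, so restricting the supremum to them only lowers it; no
  -- approximation in `Z` is needed in this direction.
  have hle := le_ciSup (IsLipschitzZero.bddAbove (fun Z => hK v Y Z) (A, B)) ⟨z k, hz k⟩
  simp only at hle
  -- Three errors: replacing $v$ in the `A` term, $Y$ in the `B` term, and $v$ in the `B` term. Only
  -- the first involves `A`, hence the shape $C\|A\|+C'$.
  have e1 := (le_abs_self _).trans (abs_matInner_matComb_le ((u i).1 - v.1) A (z k))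
  have e2 := (le_abs_self _).trans (abs_matInner_matComb_le (u i).1 B ((u i).2 - Y.1))
  have e3 := (le_abs_self _).trans (abs_matInner_matComb_le ((u i).1 - v.1) B Y.1)
  rw [matComb_sub_left, matInner_sub_left] at e1 e3
  rw [matInner_sub_right, hu1, mul_one] at e2
  have f1 : (D₁ : ℝ) * D₁ * (M * ‖(u i).1 - v.1‖ * ‖A‖) * ‖z k‖ ≤ δ * (D₁ * D₁ * M * R * ‖A‖) := by
    calc _ ≤ (D₁ : ℝ) * D₁ * (M * δ * ‖A‖) * R := by gcongr; exact hR _ (hz k)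
      _ = _ := by ring
  have f2 : (D₂ : ℝ) * D₂ * (M * ‖B‖) * ‖(u i).2 - Y.1‖ ≤ δ * (D₂ * D₂ * (M * ‖B‖)) := by
    calc _ ≤ (D₂ : ℝ) * D₂ * (M * ‖B‖) * δ := by gcongr
      _ = _ := by ring
  have f3 : (D₂ : ℝ) * D₂ * (M * ‖(u i).1 - v.1‖ * ‖B‖) * ‖Y.1‖
      ≤ δ * (D₂ * D₂ * (M * ‖B‖) * S) := by
    calc _ ≤ (D₂ : ℝ) * D₂ * (M * δ * ‖B‖) * S := by gcongr; exact hS _ Y.2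
      _ = _ := by ring
  linarith

/-- Bounded sets are totally bounded in finite dimension. The centres are kept inside `s` so that
they still satisfy the norm constraints. -/
lemma exists_finite_net {E : Type*} [NormedAddCommGroup E] [NormedSpace ℝ E]
    [FiniteDimensional ℝ E] {s : Set E} (hs : s.Nonempty) {R : ℝ} (hR : ∀ x ∈ s, ‖x‖ ≤ R) {δ : ℝ}
    (hδ : 0 < δ) : ∃ t : Set E, t.Finite ∧ t.Nonempty ∧ t ⊆ s ∧ ∀ x ∈ s, ∃ y ∈ t, ‖x - y‖ ≤ δ := by
  have htb : TotallyBounded s := by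
    have := FiniteDimensional.proper ℝ E
    exact (isCompact_closedBall (0 : E) R).totallyBounded.subset fun x hx => by
      simpa using hR x hx
  obtain ⟨t, hts, htf, hcov⟩ := Metric.finite_approx_of_totallyBounded htb δ hδ
  have h : ∀ x ∈ s, ∃ y ∈ t, ‖x - y‖ ≤ δ := fun x hx => by
    obtain ⟨y, hy, hxy⟩ := Set.mem_iUnion₂.1 (hcov hx)
    exact ⟨y, hy, by rw [← dist_eq_norm]; exact (Metric.mem_ball.1 hxy).le⟩
  obtain ⟨x, hx⟩ := hs
  obtain ⟨y, hy, -⟩ := h x hx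
  exact ⟨t, htf, ⟨y, hy⟩, hts, h⟩

end MinMax

/-! ### The inequality for fixed `B`. -/

section Main

/-- The rotation by $\pi$ negates both coordinates of $\mu\otimes\mu$; project to the first. -/
lemma ProbabilityTheory.IsGaussian.map_neg_eq_self {E : Type*} [NormedAddCommGroup E]
    [NormedSpace ℝ E] [CompleteSpace E] [SecondCountableTopology E] [MeasurableSpace E]
    [BorelSpace E] {μ : Measure E} [IsGaussian μ] (hμ : μ[id] = 0) :
    μ.map (fun x => -x) = μ := by
  have h := IsGaussian.map_rotation_eq_self hμ Real.pi
  have h1 := congrArg (Measure.map Prod.fst) h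
  rw [Measure.map_map (by fun_prop) (by fun_prop)] at h1
  have e : (Prod.fst ∘ ⇑(ContinuousLinearMap.rotation Real.pi : E × E →L[ℝ] E × E))
      = (fun x => -x) ∘ Prod.fst := by
    ext x; simp [ContinuousLinearMap.rotation_apply]
  rw [e, ← Measure.map_map (by fun_prop) (by fun_prop)] at h1
  simpa [Measure.map_fst_prod] using h1

variable {M D₁ D₂ : ℕ} {p : Seminorm ℝ (Matrix (Fin D₁) (Fin D₁) ℝ)}
  {b : Seminorm ℝ (Matrix (Fin D₂) (Fin D₂) ℝ)} [NeZero M] [NeZero D₁] [NeZero D₂]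

lemma integrable_seminorm_gaussianEnsemble {m n : ℕ}
    (p : Seminorm ℝ (Matrix (Fin m) (Fin n) ℝ)) : Integrable p (gaussianEnsemble m n) := by
  obtain ⟨C, hC, h⟩ := p.exists_le_mul_norm
  refine IsGaussian.integrable_of_abs_sub_le (K := C) fun x y => ?_
  have h1 := h (x - y)
  exact (abs_sub_map_le_sub p x y).trans h1

/-- The comparison inequality for fixed matrices `B`. -/
lemma integral_sub_integral_le_integral_infSupFun (hp : ∀ X, p X = 0 → X = 0)
    (hb : ∀ Y, b Y = 0 → Y = 0) (B : Fin M → Matrix (Fin D₂) (Fin D₂) ℝ) :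
    ∫ X, p X ∂(gaussianEnsemble D₁ D₁)
      - ∫ g, supSupFun (normSigma p) b (-g) (-B) ∂(stdGaussian (EuclideanSpace ℝ (Fin M)))
      ≤ ∫ A, infSupFun p b A B ∂(Measure.pi fun _ : Fin M => gaussianEnsemble D₁ D₁) := by
  set α := gaussianEnsemble D₁ D₁
  set π := Measure.pi fun _ : Fin M => α
  set γ := stdGaussian (EuclideanSpace ℝ (Fin M))
  obtain ⟨C, C', hC, hC', happ⟩ := exists_ciInf_le_infSupFun_add (M := M) hp hb B
  obtain ⟨R, hR0, hR⟩ := exists_norm_le_of_dualNorm_eq_one hp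
  obtain ⟨S, hS0, hS⟩ := exists_norm_le_of_eq_one hb
  have iA : Integrable (fun A => infSupFun p b A B) π := by
    obtain ⟨K, hK⟩ := exists_isLipschitzZero_infSupFun (M := M) hp hb
    refine IsGaussian.integrable_of_abs_sub_le (K := K) fun x y => ?_
    simpa using hK.2 (x, B) (y, B)
  have ig : Integrable (fun g => supSupFun (normSigma p) b (-g) (-B)) γ := by
    obtain ⟨K, hK⟩ := exists_isLipschitzZero_supSupFun (M := M) (normSigma p) hb
    refine IsGaussian.integrable_of_abs_sub_le (K := K) fun x y => ?_
    have := hK.2 (-x, -B) (-y, -B)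
    rw [Prod.mk_sub_mk, sub_self, neg_sub_neg, Prod.norm_mk, norm_zero,
      max_eq_left (norm_nonneg _), norm_sub_rev] at this
    exact this
  have ip : Integrable p α := integrable_seminorm_gaussianEnsemble p
  have inX : Integrable (fun X : Matrix (Fin D₁) (Fin D₁) ℝ => ‖X‖) α :=
    (IsGaussian.integrable_id (μ := α)).norm
  have inA : Integrable (fun A : Fin M → Matrix (Fin D₁) (Fin D₁) ℝ => ‖A‖) π :=
    (IsGaussian.integrable_id (μ := π)).norm
  -- The total coefficient of the mesh `δ`: the loss in $\mathbb{E}\,p$ from the net of `Z`, plus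
  -- the loss in the min-max from the net of $(v,Y)$.
  set N := D₁ * D₁ * ∫ X, ‖X‖ ∂α + (C * ∫ A, ‖A‖ ∂π + C') with hN
  have hN0 : 0 ≤ N := by positivity
  have key : ∀ δ : ℝ, 0 < δ →
      ∫ X, p X ∂α - ∫ g, supSupFun (normSigma p) b (-g) (-B) ∂γ
        ≤ ∫ A, infSupFun p b A B ∂π + δ * N := by
    intro δ hδ
    obtain ⟨⟨v₀, hv₀⟩⟩ := nonempty_norm_eq_one (M := M)
    obtain ⟨⟨Y₀, hY₀⟩⟩ := nonempty_seminorm_eq_one hb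
    obtain ⟨⟨Z₀, hZ₀⟩⟩ := nonempty_dualNorm_eq_one hp
    obtain ⟨t, htf, htn, hts, htc⟩ := exists_finite_net
      (s := {x : EuclideanSpace ℝ (Fin M) × Matrix (Fin D₂) (Fin D₂) ℝ | ‖x.1‖ = 1 ∧ b x.2 = 1})
      ⟨(v₀, Y₀), hv₀, hY₀⟩ (R := max 1 S)
      (fun x hx => max_le_max hx.1.le (hS _ hx.2)) hδ
    obtain ⟨s, hsf, hsn, hss, hsc⟩ := exists_finite_net
      (s := {Z : Matrix (Fin D₁) (Fin D₁) ℝ | dualNorm p Z = 1}) ⟨Z₀, hZ₀⟩ (R := R) hR hδ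
    have := htf.fintype
    have := hsf.fintype
    have := htn.to_subtype
    have := hsn.to_subtype
    have hch := chevet_finite (M := M) (ι := t) (κ := s) α integral_id_gaussianEnsemble
      (fun k => matInnerCLM k.1) (σ := normSigma p)
      (fun k l => by
        rw [covariance_matInner_gaussianEnsemble]
        exact matInner_le_normSigma_sq hp (hss k.2) (hss l.2))
      (fun u => u.1.1) (fun u => (hts u.2).1) (fun u => matInner (matComb u.1.1 B) u.1.2)
    have h1 : ∫ X, p X ∂α ≤ ∫ X, ⨆ k : s, matInnerCLM k.1 X ∂α + δ * (D₁ * D₁ * ∫ X, ‖X‖ ∂α) := by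
      -- `p X` is attained at some `Z` of the dual sphere, and moving `Z` to the net costs at most a
      -- multiple of $\delta\|X\|$.
      have hle : ∀ X, p X ≤ (⨆ k : s, matInnerCLM k.1 X) + δ * (D₁ * D₁ * ‖X‖) := fun X => by
        obtain ⟨Z, hZ, hXZ⟩ := exists_le_matInner hp X
        obtain ⟨k, hk, hkZ⟩ := hsc Z hZ
        have e1 : matInner X k ≤ ⨆ k : s, matInnerCLM k.1 X :=
          le_ciSup (f := fun k : s => matInnerCLM k.1 X) (Set.finite_range _).bddAbove ⟨k, hk⟩
        have e2 := (le_abs_self _).trans (abs_matInner_le X (Z - k))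
        rw [matInner_sub_right] at e2
        have e3 : (D₁ : ℝ) * D₁ * ‖X‖ * ‖Z - k‖ ≤ D₁ * D₁ * ‖X‖ * δ := by gcongr
        rw [hXZ]
        linarith
      have i1 : Integrable (fun X => ⨆ k : s, matInnerCLM k.1 X) α := by
        obtain ⟨K, hK⟩ := exists_abs_sub_le_of_finite fun k : s => matInnerCLM k.1
        exact IsGaussian.integrable_of_abs_sub_le fun x y => abs_ciSup_sub_ciSup_le
          (Set.finite_range _).bddAbove (Set.finite_range _).bddAbove fun k => hK k x y
      refine (integral_mono ip (i1.add ((inX.const_mul _).const_mul δ)) hle).trans_eq ?_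
      rw [integral_add' i1 ((inX.const_mul _).const_mul δ), integral_const_mul, integral_const_mul]
    have h2 : -∫ g, supSupFun (normSigma p) b (-g) (-B) ∂γ ≤
        ∫ g, ⨅ u : t, (normSigma p * inner ℝ g u.1.1 + matInner (matComb u.1.1 B) u.1.2) ∂γ := by
      rw [← integral_neg]
      refine integral_mono ig.neg ?_ fun g => le_ciInf fun u =>
        neg_supSupFun_neg_le (normSigma p) hb g B (hts u.2).1 (hts u.2).2
      obtain ⟨K, hK⟩ := exists_abs_sub_le_of_finite fun u : t => normSigma p • innerSL ℝ u.1.1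
      refine IsGaussian.integrable_of_abs_sub_le (K := K) fun x y => abs_ciInf_sub_ciInf_le
        (Set.finite_range _).bddBelow (Set.finite_range _).bddBelow fun u => ?_
      rw [add_sub_add_right_eq_sub]
      simpa [real_inner_comm] using hK u x y
    have h3 : ∫ A, ⨅ u : t, ((⨆ k : s, matInnerCLM k.1 (∑ i, u.1.1 i • A i))
        + matInner (matComb u.1.1 B) u.1.2) ∂π
        ≤ ∫ A, infSupFun p b A B ∂π + δ * (C * ∫ A, ‖A‖ ∂π + C') := by
      have hle : ∀ A : Fin M → Matrix (Fin D₁) (Fin D₁) ℝ,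
          ⨅ u : t, ((⨆ k : s, matInnerCLM k.1 (∑ i, u.1.1 i • A i))
            + matInner (matComb u.1.1 B) u.1.2) ≤ infSupFun p b A B + δ * (C * ‖A‖ + C') := fun A =>
        happ δ hδ (fun u : t => u.1) (fun u => (hts u.2).1)
          (fun x hx hY => by
            obtain ⟨y, hy, h⟩ := htc x ⟨hx, hY⟩
            exact ⟨⟨y, hy⟩, h⟩)
          (fun k : s => k.1) (fun k => hss k.2) A
      have ir : Integrable (fun A : Fin M → Matrix (Fin D₁) (Fin D₁) ℝ =>
          δ * (C * ‖A‖ + C')) π := ((inA.const_mul C).add (integrable_const _)).const_mul δ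
      have il : Integrable (fun A : Fin M → Matrix (Fin D₁) (Fin D₁) ℝ =>
          ⨅ u : t, ((⨆ k : s, matInnerCLM k.1 (∑ i, u.1.1 i • A i))
            + matInner (matComb u.1.1 B) u.1.2)) π := by
        obtain ⟨K, hK⟩ := exists_abs_sub_le_of_finite fun q : t × s => (matInnerCLM q.2.1).comp
          (∑ i, q.1.1.1 i • ContinuousLinearMap.proj (R := ℝ)
            (φ := fun _ : Fin M => Matrix (Fin D₁) (Fin D₁) ℝ) i)
        refine IsGaussian.integrable_of_abs_sub_le (K := K) fun x y => abs_ciInf_sub_ciInf_le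
          (Set.finite_range _).bddBelow (Set.finite_range _).bddBelow fun u => ?_
        rw [add_sub_add_right_eq_sub]
        refine abs_ciSup_sub_ciSup_le (Set.finite_range _).bddAbove (Set.finite_range _).bddAbove
          fun k => ?_
        simpa using hK (u, k) x y
      refine (integral_mono il (iA.add ir) hle).trans_eq ?_
      rw [integral_add' iA ir, integral_const_mul, integral_add (inA.const_mul C)
        (integrable_const _), integral_const_mul]
      simp
    rw [hN]
    linarith
  refine le_of_forall_pos_le_add fun ε hε => ?_
  -- The denominator is $N+1$ because `N` may vanish.
  have := key (ε / (N + 1)) (by positivity)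
  have h : ε / (N + 1) * N ≤ ε := by
    rw [div_mul_eq_mul_div, div_le_iff₀ (by positivity)]
    nlinarith
  linarith

end Main

/-! ### Averaging over `B`. -/

section Transfer

variable {M D₁ D₂ : ℕ} {p : Seminorm ℝ (Matrix (Fin D₁) (Fin D₁) ℝ)}
  {b : Seminorm ℝ (Matrix (Fin D₂) (Fin D₂) ℝ)} [NeZero M] [NeZero D₁] [NeZero D₂]

lemma integrable_infSupFun (hp : ∀ X, p X = 0 → X = 0) (hb : ∀ Y, b Y = 0 → Y = 0) :
    Integrable (fun x : (Fin M → Matrix (Fin D₁) (Fin D₁) ℝ) ×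
        (Fin M → Matrix (Fin D₂) (Fin D₂) ℝ) => infSupFun p b x.1 x.2)
      ((Measure.pi fun _ => gaussianEnsemble D₁ D₁).prod
        (Measure.pi fun _ => gaussianEnsemble D₂ D₂)) := by
  obtain ⟨K, hK⟩ := exists_isLipschitzZero_infSupFun (M := M) hp hb
  exact IsGaussian.integrable_of_abs_sub_le hK.2

lemma integrable_supSupFun (s : ℝ) (hb : ∀ Y, b Y = 0 → Y = 0) :
    Integrable (fun x : EuclideanSpace ℝ (Fin M) × (Fin M → Matrix (Fin D₂) (Fin D₂) ℝ) =>
        supSupFun s b x.1 x.2)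
      ((stdGaussian (EuclideanSpace ℝ (Fin M))).prod
        (Measure.pi fun _ => gaussianEnsemble D₂ D₂)) := by
  obtain ⟨K, hK⟩ := exists_isLipschitzZero_supSupFun (M := M) s hb
  exact IsGaussian.integrable_of_abs_sub_le hK.2

lemma integral_sub_integral_supSupFun_le (hp : ∀ X, p X = 0 → X = 0)
    (hb : ∀ Y, b Y = 0 → Y = 0) :
    ∫ X, p X ∂(gaussianEnsemble D₁ D₁)
      - ∫ x, supSupFun (normSigma p) b x.1 x.2 ∂((stdGaussian (EuclideanSpace ℝ (Fin M))).prod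
        (Measure.pi fun _ : Fin M => gaussianEnsemble D₂ D₂))
      ≤ ∫ x, infSupFun p b x.1 x.2 ∂((Measure.pi fun _ : Fin M => gaussianEnsemble D₁ D₁).prod
        (Measure.pi fun _ : Fin M => gaussianEnsemble D₂ D₂)) := by
  set π₁ := Measure.pi fun _ : Fin M => gaussianEnsemble D₁ D₁
  set π₂ := Measure.pi fun _ : Fin M => gaussianEnsemble D₂ D₂
  set γ := stdGaussian (EuclideanSpace ℝ (Fin M))
  have hI := integrable_infSupFun (M := M) hp hb
  have hS := integrable_supSupFun (M := M) (normSigma p) hb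
  have hπ₂ : π₂[id] = 0 := integral_id_pi_eq_zero _ fun _ => integral_id_gaussianEnsemble
  have hc : (γ.prod π₂)[id] = 0 := by
    simpa using isGaussian_map_prod_centered (μ := γ) (ν := π₂) (by simp [γ]) hπ₂
      (ContinuousLinearMap.id ℝ _)
  have hneg := IsGaussian.map_neg_eq_self hc
  have hS' : Integrable (fun x : EuclideanSpace ℝ (Fin M) ×
      (Fin M → Matrix (Fin D₂) (Fin D₂) ℝ) => supSupFun (normSigma p) b (-x.1) (-x.2))
      (γ.prod π₂) := by
    have h := hS
    rw [← hneg] at h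
    exact h.comp_measurable measurable_neg
  -- The pair $(g,B)$ is jointly centred Gaussian, so both signs may be flipped at once; this undoes
  -- the negations of the inequality for fixed `B`.
  have hsymm : ∫ x, supSupFun (normSigma p) b x.1 x.2 ∂(γ.prod π₂)
      = ∫ x, supSupFun (normSigma p) b (-x.1) (-x.2) ∂(γ.prod π₂) := by
    have h := hS.aestronglyMeasurable
    conv_lhs => rw [← hneg]
    rw [integral_map measurable_neg.aemeasurable (by rw [hneg]; exact h)]
    rfl
  rw [hsymm, integral_prod_symm _ hI, integral_prod_symm _ hS']
  have hconst : ∫ X, p X ∂(gaussianEnsemble D₁ D₁)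
      = ∫ _B, ∫ X, p X ∂(gaussianEnsemble D₁ D₁) ∂π₂ := by simp
  rw [hconst, ← integral_sub (integrable_const _) hS'.integral_prod_right]
  exact integral_mono ((integrable_const _).sub hS'.integral_prod_right) hI.integral_prod_right
    fun B => integral_sub_integral_le_integral_infSupFun hp hb B

end Transfer

end MatrixNorm

/-! ### From laws to random variables. -/

lemma ProbabilityTheory.iIndepFun.map_eq_pi_of_hasLaw {Ω ι E : Type*} [MeasurableSpace Ω]
    [Fintype ι] [MeasurableSpace E] {P : Measure Ω} [IsProbabilityMeasure P] {X : ι → Ω → E}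
    {μ : Measure E} (h : iIndepFun X P) (hX : ∀ i, HasLaw (X i) μ P) :
    P.map (fun ω i => X i ω) = Measure.pi fun _ => μ := by
  rw [(iIndepFun_iff_map_fun_eq_pi_map fun i => (hX i).aemeasurable).1 h]
  simp_rw [fun i => (hX i).map_eq]

theorem mainTheorem6 {Ω : Type*} [MeasurableSpace Ω] (P : Measure Ω) [IsProbabilityMeasure P]
    (M D₁ D₂ : ℕ) (hM : 1 ≤ M) (hD₁ : 1 ≤ D₁) (hD₂ : 1 ≤ D₂)
    (p : Seminorm ℝ (Matrix (Fin D₁) (Fin D₁) ℝ)) (hp : ∀ X, p X = 0 → X = 0)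
    (b : Seminorm ℝ (Matrix (Fin D₂) (Fin D₂) ℝ)) (hb : ∀ Y, b Y = 0 → Y = 0)
    (g : Ω → EuclideanSpace ℝ (Fin M))
    (G : Fin (M + 1) → Ω → Matrix (Fin D₁) (Fin D₁) ℝ)
    (G' : Fin M → Ω → Matrix (Fin D₂) (Fin D₂) ℝ)
    (hg : HasLaw g (stdGaussian (EuclideanSpace ℝ (Fin M))) P)
    (hG : ∀ i, HasLaw (G i) (gaussianEnsemble D₁ D₁) P)
    (hG' : ∀ i, HasLaw (G' i) (gaussianEnsemble D₂ D₂) P)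
    (hGind : iIndepFun G P)
    (hG'ind : iIndepFun G' P)
    (hGG' : IndepFun (fun ω i => G i ω) (fun ω i => G' i ω) P)
    (hgGG' : IndepFun g (fun ω => ((fun i => G i ω), (fun i => G' i ω))) P) :
    Integrable (fun ω => infSupFun p b (fun i => G i.succ ω) (fun i => G' i ω)) P ∧
    Integrable (fun ω => p (G 0 ω)) P ∧
    Integrable (fun ω => supSupFun (normSigma p) b (g ω) (fun i => G' i ω)) P ∧
    (∫ ω, p (G 0 ω) ∂P) - (∫ ω, supSupFun (normSigma p) b (g ω) (fun i => G' i ω) ∂P) ≤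
      ∫ ω, infSupFun p b (fun i => G i.succ ω) (fun i => G' i ω) ∂P := by
  have : NeZero M := ⟨by omega⟩
  have : NeZero D₁ := ⟨by omega⟩
  have : NeZero D₂ := ⟨by omega⟩
  have mG : AEMeasurable (fun ω (i : Fin M) => G i.succ ω) P :=
    aemeasurable_pi_lambda _ fun i => (hG i.succ).aemeasurable
  have mG' : AEMeasurable (fun ω i => G' i ω) P :=
    aemeasurable_pi_lambda _ fun i => (hG' i).aemeasurable
  have lG : P.map (fun ω (i : Fin M) => G i.succ ω)
      = Measure.pi fun _ => gaussianEnsemble D₁ D₁ :=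
    (hGind.precomp (Fin.succ_injective M)).map_eq_pi_of_hasLaw fun i => hG i.succ
  have lG' := hG'ind.map_eq_pi_of_hasLaw hG'
  -- Each expectation depends on one law only: that of $(G_1,\dots,G_M,G')$ here, that of $(g,G')$
  -- next, and that of $G_0$.
  have l₁ : P.map (fun ω => ((fun i : Fin M => G i.succ ω), fun i => G' i ω))
      = (Measure.pi fun _ => gaussianEnsemble D₁ D₁).prod
        (Measure.pi fun _ => gaussianEnsemble D₂ D₂) := by
    have h : IndepFun (fun ω (i : Fin M) => G i.succ ω) (fun ω i => G' i ω) P :=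
      hGG'.comp (φ := fun A (i : Fin M) => A i.succ) (ψ := id)
        (measurable_pi_lambda _ fun i => measurable_pi_apply _) measurable_id
    rw [(indepFun_iff_map_prod_eq_prod_map_map mG mG').1 h, lG, lG']
  have l₂ : P.map (fun ω => (g ω, fun i => G' i ω))
      = (stdGaussian (EuclideanSpace ℝ (Fin M))).prod
        (Measure.pi fun _ => gaussianEnsemble D₂ D₂) := by
    have h : IndepFun g (fun ω i => G' i ω) P := hgGG'.comp measurable_id measurable_snd
    rw [(indepFun_iff_map_prod_eq_prod_map_map hg.aemeasurable mG').1 h, hg.map_eq, lG']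
  have hI := integrable_infSupFun (M := M) hp hb
  have hS := integrable_supSupFun (M := M) (normSigma p) hb
  have hP := integrable_seminorm_gaussianEnsemble p
  have main := integral_sub_integral_supSupFun_le (M := M) hp hb
  rw [← l₁] at hI
  rw [← l₂] at hS
  rw [← (hG 0).map_eq] at hP
  rw [← l₁, ← l₂, ← (hG 0).map_eq, integral_map (mG.prodMk mG') hI.aestronglyMeasurable,
    integral_map (hg.aemeasurable.prodMk mG') hS.aestronglyMeasurable,
    integral_map (hG 0).aemeasurable hP.aestronglyMeasurable] at main
  exact ⟨hI.comp_aemeasurable (mG.prodMk mG'), hP.comp_aemeasurable (hG 0).aemeasurable,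
    hS.comp_aemeasurable (hg.aemeasurable.prodMk mG'), main⟩
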